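/- All rings are associative with $1$ (not necessarily commutative), all modules are unitary left modules, and $\mathbb N=\{1,2,\dots\}$. An algebra $\mathbf A=(A,F)$ is a set $A$ with a set $F$ of finitary operations on $A$; $\mathrm{Clo}(\mathbf A)$ denotes the set of its term functions of positive arity. Two algebras on the same universe are polynomially equivalent if they have the same polynomial functions (term functions with constants from the universe substituted for some variables). A clonoid from $\mathbf A$ to $\mathbf B$ is a set $C\subseteq\bigcup_{k\in\mathbb N}B^{A^k}$ such that $f(s_1,\dots,s_k)\in C$ for all $k,m\in\mathbb N$, all $k$-ary $f\in C$ and all $m$-ary $s_1,\dots,s_k\in\mathrm{Clo}(\mathbf A)$, and $t(f_1,\dots,f_k)\in C$ for all $k,m\in\mathbb N$, all $k$-ary $t\in\mathrm{Clo}(\mathbf B)$ and all $m$-ary $f_1,\dots,f_k\in C$. It is generated by its $m$-ary functions if it is the smallest clonoid from $\mathbf A$ to $\mathbf B$ containing all $m$-ary members of $C$. A module is distributive if its lattice of submodules is distributive. **Theorem.** Let $R$ be a ring with Jacobson radical $J(R)$ such that $R/J(R)$ is semisimple (for instance, $R$ finite, or $R$ left Artinian, or $R$ acting faithfully on the finite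 module below), and let $n\in\mathbb N$ with $J(R)^n=0$ (for instance, $n$ the nilpotence degree of $J(R)$). Let $\mathbf A$ be an algebra that is polynomially equivalent to a finite distributive $R$-module with universe $A$. Let $S$ be a ring in which $|A|$ is invertible, and let $\mathbf B$ be an algebra that is polynomially equivalent to an $S$-module. Then: 1. Every clonoid from $\mathbf A$ to $\mathbf B$ is generated by its $(n+1)$-ary functions. If $\mathbf A$ is itself the $R$-module (or has the same term functions as it), then every clonoid from $\mathbf A$ to $\mathbf B$ is generated by its $n$-ary functions. 2. If $\mathbf B$ is finite, then there are only finitely many clonoids from $\mathbf A$ to $\mathbf B$. -/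

import Mathlib

/-- An algebra with universe `A`: a set of basic operations, sorted by their (finite) arity.
Nullary operations are allowed. -/
structure FinitaryAlgebra (A : Type*) where
  /-- the basic operations of arity `k` -/
  ops : ∀ k : ℕ, Set ((Fin k → A) → A)

/-- A set of finitary functions from `A` to `B` of positive arities, sorted by arity:
`C k` is the set of `k`-ary members. These are ordered by inclusion (arity by arity). -/
abbrev FunctionClass (A B : Type*) := ∀ k : ℕ+, Set ((Fin k → A) → B)

namespace FunctionClass

variable {A B D : Type*}

/-- Function class composition: all `f (s₁, …, sₖ)` with `f` a `k`-ary member of `F` and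
`s₁, …, sₖ` members of `G` of the same arity `m`. -/
def comp (F : FunctionClass B D) (G : FunctionClass A B) : FunctionClass A D :=
  fun m => {h | ∃ (k : ℕ+) (f : (Fin k → B) → D) (s : Fin k → (Fin m → A) → B),
    f ∈ F k ∧ (∀ i, s i ∈ G m) ∧ h = fun x => f (fun i => s i x)}

/-- The subclass of the `n`-ary members of `C`. -/
def aryPart (C : FunctionClass A B) (n : ℕ+) : FunctionClass A B :=
  fun k => {f | k = n ∧ f ∈ C k}

end FunctionClass

namespace FinitaryAlgebra

variable {A B : Type*}

/-- The term functions in `m` variables: the smallest set of `m`-ary functions that contains the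
projections and is closed under the basic operations. -/
inductive IsTermFunction (𝔸 : FinitaryAlgebra A) {m : ℕ} : ((Fin m → A) → A) → Prop
  | proj (i : Fin m) : IsTermFunction 𝔸 (fun x => x i)
  | app {k : ℕ} {g : (Fin k → A) → A} (hg : g ∈ 𝔸.ops k) (t : Fin k → (Fin m → A) → A)
      (ht : ∀ i, IsTermFunction 𝔸 (t i)) : IsTermFunction 𝔸 (fun x => g (fun i => t i x))

/-- The clone of term functions of an algebra (positive arities). -/
def clo (𝔸 : FinitaryAlgebra A) : FunctionClass A A :=
  fun m => {f : (Fin m → A) → A | 𝔸.IsTermFunction f}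

/-- The expansion of an algebra by all constant operations on its universe. -/
def withConstants (𝔸 : FinitaryAlgebra A) : FinitaryAlgebra A where
  ops k := 𝔸.ops k ∪ {g | ∃ a : A, g = fun _ => a}

/-- The clone of polynomial functions of an algebra. -/
def polyClo (𝔸 : FinitaryAlgebra A) : FunctionClass A A :=
  𝔸.withConstants.clo

/-- Two algebras on the same universe are term equivalent if they have the same term functions. -/
def TermEquivalent (𝔸₁ 𝔸₂ : FinitaryAlgebra A) : Prop :=
  𝔸₁.clo = 𝔸₂.clo

/-- Two algebras on the same universe are polynomially equivalent if they have the same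
polynomial functions. -/
def PolynomiallyEquivalent (𝔸₁ 𝔸₂ : FinitaryAlgebra A) : Prop :=
  𝔸₁.polyClo = 𝔸₂.polyClo

/-- The basic operations of a (left) module: `0`, `-x`, `x + y` and `r • x` for each scalar `r`. -/
inductive IsModuleOperation (R A : Type*) [Ring R] [AddCommGroup A] [Module R A] :
    ∀ k : ℕ, ((Fin k → A) → A) → Prop
  | zero : IsModuleOperation R A 0 (fun _ => 0)
  | neg : IsModuleOperation R A 1 (fun x => -x 0)
  | add : IsModuleOperation R A 2 (fun x => x 0 + x 1)
  | smul (r : R) : IsModuleOperation R A 1 (fun x => r • x 0)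

/-- A module, viewed as an algebra on its universe. -/
def ofModule (R A : Type*) [Ring R] [AddCommGroup A] [Module R A] : FinitaryAlgebra A where
  ops k := {g | IsModuleOperation R A k g}

/-- `C` is a clonoid from `𝔸` to `𝔹`: `C Clo(𝔸) ⊆ C` and `Clo(𝔹) C ⊆ C`. -/
def IsClonoid (𝔸 : FinitaryAlgebra A) (𝔹 : FinitaryAlgebra B) (C : FunctionClass A B) : Prop :=
  C.comp 𝔸.clo ≤ C ∧ FunctionClass.comp 𝔹.clo C ≤ C

/-- The clonoid from `𝔸` to `𝔹` generated by `F`: the intersection of all clonoids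
containing `F`. -/
def clonoidGenerated (𝔸 : FinitaryAlgebra A) (𝔹 : FinitaryAlgebra B) (F : FunctionClass A B) :
    FunctionClass A B :=
  sInf {C | IsClonoid 𝔸 𝔹 C ∧ F ≤ C}

end FinitaryAlgebra

/-- A module is distributive if its lattice of submodules is distributive. -/
def IsDistributiveModule (R A : Type*) [Ring R] [AddCommGroup A] [Module R A] : Prop :=
  ∀ X Y Z : Submodule R A, X ⊓ (Y ⊔ Z) = (X ⊓ Y) ⊔ (X ⊓ Z)

/-! The heart is a rank identity. Let the k×k matrices over R act on the group algebra of A^k. Then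
some combination Σ s_i [v_i h_i] of matrices factoring through R^r acts as the identity, where r =
2, or r = 1 if A is semisimple, independently of k. Hence f(x) = Σ s_i f(v_i h_i x) for every f,
with Σ s_i = 1 (`exists_sum_smul_comp`). For f in a clonoid, y ↦ f(v_i y) is an r-ary member when
the module operations are term functions, and idempotent combinations are term functions of 𝔹, so
the r-ary members generate f. If 𝔸 is only polynomially equivalent to the module, matrices act
relative to a base point, which costs one variable. As n = 1 gives J(R) = 0 and semisimplicity, r ≤
n always.

The identity is proved by induction on |A|. Factors 1 - κ can be multiplied, so tuples spanning
proper submodules are left to the induction, and everything else is done modulo them. For a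
generating tuple x, weighting the matrices v h by c(h x) sends φ(x) to v φ(c) for each automorphism
φ, up to a unit, and kills all tuples outside the orbit of x, provided that c sums to zero over the
cosets of T^r for each minimal submodule T (`exists_rankSpan_interpolation`). A distributive A has a
single generator g. If T is not in the radical, it has a maximal complement containing all other
minimal submodules, so the point mass at g can be corrected at non-generating tuples to meet the
condition at T (`exists_avg_mul_eq_zero`). In the semisimple case this covers every T, and r = 1.

In general put ω = ∏ (1 - avg T) over the minimal T in the radical. Induction on the quotients A/T
leaves only elements fixed by ω, so it suffices to realise multiplication by ω modulo non-generating
tuples. Since ω lives on a semisimple submodule, rank one matrices reproduce it; one more column,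
for g, gives rank two (`exists_rankSpan_two_interpolation`). -/

namespace FinitaryAlgebra

variable {A B : Type*}

/-! ### Term functions of algebras polynomially equivalent to a module -/

theorem IsTermFunction.subst {𝔸 : FinitaryAlgebra A} {m n : ℕ} {f : (Fin m → A) → A}
    (hf : 𝔸.IsTermFunction f) {g : Fin m → (Fin n → A) → A} (hg : ∀ i, 𝔸.IsTermFunction (g i)) :
    𝔸.IsTermFunction (fun x => f (fun i => g i x)) := by
  induction hf with
  | proj i => exact hg i
  | app ho t _ ih => exact IsTermFunction.app ho (fun i x => t i (fun j => g j x)) ih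

theorem IsTermFunction.withConstants {𝔸 : FinitaryAlgebra A} {m : ℕ} {f : (Fin m → A) → A}
    (hf : 𝔸.IsTermFunction f) : 𝔸.withConstants.IsTermFunction f := by
  induction hf with
  | proj i => exact .proj i
  | app ho t _ ih => exact .app (Or.inl ho) t ih

theorem isTermFunction_of_mem_ops {𝔸 : FinitaryAlgebra A} {m : ℕ} {f : (Fin m → A) → A}
    (hf : f ∈ 𝔸.ops m) : 𝔸.IsTermFunction f :=
  IsTermFunction.app hf (fun i x => x i) fun i => .proj i

section Module

variable {S : Type*} [Ring S] [AddCommGroup B] [Module S B]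

theorem isTermFunction_ofModule_linear {m : ℕ} (s : Fin m → S) :
    (ofModule S B).IsTermFunction (fun x : Fin m → B => ∑ i, s i • x i) := by
  suffices h : ∀ I : Finset (Fin m),
      (ofModule S B).IsTermFunction (fun x : Fin m → B => ∑ i ∈ I, s i • x i) from h _
  intro I
  induction I using Finset.induction_on with
  | empty =>
    simp only [Finset.sum_empty]
    exact IsTermFunction.app (𝔸 := ofModule S B) (k := 0) (g := fun _ => 0) IsModuleOperation.zero
      (fun i => i.elim0) fun i => i.elim0
  | insert a I ha ih =>
    simp only [Finset.sum_insert ha]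
    have h1 : (ofModule S B).IsTermFunction (fun x : Fin m → B => s a • x a) :=
      IsTermFunction.app (𝔸 := ofModule S B) (k := 1) (g := fun x => s a • x 0) (IsModuleOperation.smul (s a))
        (fun _ x => x a) fun _ => .proj a
    refine IsTermFunction.app (𝔸 := ofModule S B) (k := 2) (g := fun x => x 0 + x 1) IsModuleOperation.add
      ![fun x => s a • x a, fun x => ∑ i ∈ I, s i • x i] ?_
    intro i
    fin_cases i
    · exact h1
    · exact ih

theorem isTermFunction_withConstants_ofModule {m : ℕ} {f : (Fin m → B) → B}
    (hf : (ofModule S B).withConstants.IsTermFunction f) :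
    ∃ (s : Fin m → S) (b : B), ∀ x, f x = ∑ i, s i • x i + b := by
  induction hf with
  | proj i => exact ⟨Pi.single i 1, 0, fun x => by simp [Pi.single_apply]⟩
  | app ho t _ ih =>
    choose s b hs using ih
    rcases ho with ho | ⟨a, rfl⟩
    · cases ho with
      | zero => exact ⟨0, 0, fun x => by simp⟩
      | neg => exact ⟨-s 0, -b 0, fun x => by simp [hs, add_comm]⟩
      | add =>
        refine ⟨s 0 + s 1, b 0 + b 1, fun x => ?_⟩
        simp only [hs, Pi.add_apply, add_smul, Finset.sum_add_distrib]
        abel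
      | smul r =>
        exact ⟨r • s 0, r • b 0, fun x => by simp [hs, Finset.smul_sum, mul_smul]⟩
    · exact ⟨0, a, fun x => by simp⟩

variable {𝔹 : FinitaryAlgebra B}

theorem PolynomiallyEquivalent.isTermFunction_withConstants_iff
    (h𝔹 : 𝔹.PolynomiallyEquivalent (ofModule S B)) {m : ℕ} (hm : 0 < m)
    {f : (Fin m → B) → B} :
    𝔹.withConstants.IsTermFunction f ↔ (ofModule S B).withConstants.IsTermFunction f :=
  Set.ext_iff.1 (congrFun h𝔹 ⟨m, hm⟩) f

theorem PolynomiallyEquivalent.ops_affine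
    (h𝔹 : 𝔹.PolynomiallyEquivalent (ofModule S B)) {k : ℕ} {g : (Fin k → B) → B} (hg : g ∈ 𝔹.ops k) :
    ∃ (s : Fin k → S) (b : B), ∀ x, g x = ∑ i, s i • x i + b := by
  -- Polynomial equivalence only compares positive arities, so constants are treated separately.
  rcases Nat.eq_zero_or_pos k with rfl | hk
  · exact ⟨0, g 0, fun x => by simp [Subsingleton.elim x 0]⟩
  · exact isTermFunction_withConstants_ofModule ((h𝔹.isTermFunction_withConstants_iff hk).1
      (isTermFunction_of_mem_ops hg).withConstants)

/-- Replacing all constants in a polynomial function by one and the same variable. -/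
theorem PolynomiallyEquivalent.exists_term_add
    (h𝔹 : 𝔹.PolynomiallyEquivalent (ofModule S B)) {m : ℕ} {f : (Fin m → B) → B}
    (hf : 𝔹.withConstants.IsTermFunction f) (j : Fin m) :
    ∃ (t : (Fin m → B) → B) (ψ : B → B), 𝔹.IsTermFunction t ∧ ∀ x, t x = f x + ψ (x j) := by
  induction hf with
  | proj i => exact ⟨fun x => x i, 0, .proj i, fun x => by simp⟩
  | @app k g ho u _ ih =>
    choose t ψ ht htψ using ih
    rcases ho with ho | ⟨a, rfl⟩
    · obtain ⟨s, b, hs⟩ := h𝔹.ops_affine ho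
      -- The operation is affine, so errors depending on x j alone again add up to such an error.
      refine ⟨fun x => g (fun i => t i x), fun y => ∑ i, s i • ψ i y, .app ho t ht, fun x => ?_⟩
      simp only [hs, htψ, smul_add, Finset.sum_add_distrib]
      abel
    · exact ⟨fun x => x j, fun y => y - a, .proj j, fun x => by simp⟩

/-- The idempotent linear combinations are term functions. -/
theorem PolynomiallyEquivalent.isTermFunction_of_sum_eq_one
    (h𝔹 : 𝔹.PolynomiallyEquivalent (ofModule S B)) {m : ℕ} (hm : 0 < m) (s : Fin m → S)
    (hs : ∑ i, s i = 1) : 𝔹.IsTermFunction (fun x : Fin m → B => ∑ i, s i • x i) := by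
  obtain ⟨j⟩ : Nonempty (Fin m) := ⟨⟨0, hm⟩⟩
  -- The extra last variable y has coefficient -1; it serves to subtract the unknown error ψ.
  have hlin := (isTermFunction_ofModule_linear (B := B)
    (Fin.snoc s (-1) + Pi.single (Fin.castSucc j) 1 : Fin (m + 1) → S)).withConstants
  obtain ⟨t, ψ, ht, htψ⟩ := h𝔹.exists_term_add
    ((h𝔹.isTermFunction_withConstants_iff m.succ_pos).2 hlin) (Fin.castSucc j)
  have key : ∀ (x : Fin m → B) (y : B), t (Fin.snoc x y : Fin (m + 1) → B) =
      ∑ i, s i • x i - y + x j + ψ (x j) := by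
    intro x y
    rw [htψ]
    simp [add_smul, Finset.sum_add_distrib, Fin.sum_univ_castSucc, Pi.single_apply, ite_smul,
      sub_eq_add_neg]
  -- On the diagonal t takes the value x j + ψ (x j). Substituting this for y cancels both the error
  -- and the summand x j.
  have hsub : 𝔹.IsTermFunction (fun x : Fin m → B =>
      t (Fin.snoc x (t (Fin.snoc (fun _ => x j) (x j) : Fin (m + 1) → B)) :
        Fin (m + 1) → B)) := by
    have h0 : 𝔹.IsTermFunction (fun x : Fin m → B =>
        t (Fin.snoc (fun _ => x j) (x j) : Fin (m + 1) → B)) := by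
      have := ht.subst (g := fun _ (x : Fin m → B) => x j) fun _ => .proj _
      convert this using 3 with x
      ext i
      refine Fin.lastCases ?_ (fun i => ?_) i <;> simp
    have := ht.subst (g := (Fin.snoc (fun i (x : Fin m → B) => x i) (fun x : Fin m → B =>
        t (Fin.snoc (fun _ => x j) (x j) : Fin (m + 1) → B)) :
        Fin (m + 1) → (Fin m → B) → B)) fun i => by
      refine Fin.lastCases ?_ (fun i => ?_) i
      · simpa using h0
      · simpa using .proj i
    convert this using 3 with x
    ext i
    refine Fin.lastCases ?_ (fun i => ?_) i <;> simp
  convert hsub using 2 with x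
  rw [key, key, ← Finset.sum_smul, hs, one_smul]
  abel

end Module

end FinitaryAlgebra

/-! ### Group algebras and averages over subgroups -/

namespace AddMonoidAlgebra

variable {𝕜 G H : Type*} [CommRing 𝕜] [AddCommGroup G] [AddCommGroup H]

theorem span_range_single : Submodule.span 𝕜 (Set.range fun x : G => single x (1 : 𝕜)) = ⊤ := by
  refine eq_top_iff.2 fun w _ => ?_
  induction w using AddMonoidAlgebra.induction_linear with
  | zero => exact zero_mem _
  | add x y hx hy => exact add_mem (hx trivial) (hy trivial)
  | single x r =>
    have : single x r = r • single x (1 : 𝕜) := by simp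
    rw [this]
    exact Submodule.smul_mem _ _ (Submodule.subset_span ⟨x, rfl⟩)

theorem linearMap_ext {V : Type*} [AddCommGroup V] [Module 𝕜 V]
    {f g : AddMonoidAlgebra 𝕜 G →ₗ[𝕜] V} (h : ∀ x, f (single x 1) = g (single x 1)) : f = g := by
  refine LinearMap.ext_on_range span_range_single h

variable (𝕜) in
/-- The algebra homomorphism of group algebras induced by a group homomorphism. -/
noncomputable def push (f : G →+ H) : AddMonoidAlgebra 𝕜 G →ₐ[𝕜] AddMonoidAlgebra 𝕜 H :=
  mapDomainAlgHom 𝕜 𝕜 f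

@[simp] theorem push_single (f : G →+ H) (x : G) (r : 𝕜) :
    push 𝕜 f (single x r) = single (f x) r := by
  simp [push]

theorem push_push {K : Type*} [AddCommGroup K] (g : H →+ K) (f : G →+ H)
    (w : AddMonoidAlgebra 𝕜 G) : push 𝕜 g (push 𝕜 f w) = push 𝕜 (g.comp f) w := by
  have : (push 𝕜 g).toLinearMap ∘ₗ (push 𝕜 f).toLinearMap = (push 𝕜 (g.comp f)).toLinearMap :=
    linearMap_ext fun x => by simp
  exact LinearMap.congr_fun this w

theorem push_id (w : AddMonoidAlgebra 𝕜 G) : push 𝕜 (AddMonoidHom.id G) w = w := by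
  have : (push 𝕜 (AddMonoidHom.id G)).toLinearMap = LinearMap.id :=
    linearMap_ext fun x => by simp
  exact LinearMap.congr_fun this w

variable (𝕜) in
/-- The average of the elements of a subgroup, as an element of the group algebra. -/
noncomputable def avg [Finite G] (P : AddSubgroup G) : AddMonoidAlgebra 𝕜 G :=
  Ring.inverse (Nat.card P : 𝕜) • ∑ t ∈ (Set.toFinite (P : Set G)).toFinset, single t 1

theorem isUnit_natCard_subgroup [Finite G] (hG : IsUnit (Nat.card G : 𝕜)) (P : AddSubgroup G) :
    IsUnit (Nat.card P : 𝕜) :=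
  isUnit_of_dvd_unit (Nat.cast_dvd_cast P.card_addSubgroup_dvd_card) hG

variable [Finite G] {P : AddSubgroup G}

theorem single_mul_avg {t : G} (ht : t ∈ P) : single t (1 : 𝕜) * avg 𝕜 P = avg 𝕜 P := by
  rw [avg, mul_smul_comm, Finset.mul_sum]
  congr 1
  refine Finset.sum_bij' (fun s _ => t + s) (fun s _ => -t + s) ?_ ?_ ?_ ?_ ?_
  · intro s hs
    simp only [Set.Finite.mem_toFinset, SetLike.mem_coe] at hs ⊢
    exact P.add_mem ht hs
  · intro s hs
    simp only [Set.Finite.mem_toFinset, SetLike.mem_coe] at hs ⊢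
    exact P.add_mem (P.neg_mem ht) hs
  all_goals simp [single_mul_single]

theorem inverse_smul_sum_eq_of_const (hP : IsUnit (Nat.card P : 𝕜))
    {F : G → AddMonoidAlgebra 𝕜 H} {w : AddMonoidAlgebra 𝕜 H} (h : ∀ t ∈ P, F t = w) :
    Ring.inverse (Nat.card P : 𝕜) • ∑ t ∈ (Set.toFinite (P : Set G)).toFinset, F t = w := by
  rw [Finset.sum_congr rfl (fun t ht => h t (by simpa using ht)), Finset.sum_const,
    ← Nat.cast_smul_eq_nsmul 𝕜, smul_smul]
  have : (Set.toFinite (P : Set G)).toFinset.card = Nat.card P :=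
    (Nat.card_eq_card_finite_toFinset _).symm
  rw [this, Ring.inverse_mul_cancel _ hP, one_smul]

theorem avg_mul_of_absorbs (hP : IsUnit (Nat.card P : 𝕜)) {w : AddMonoidAlgebra 𝕜 G}
    (h : ∀ t ∈ P, single t 1 * w = w) : avg 𝕜 P * w = w := by
  rw [avg, smul_mul_assoc, Finset.sum_mul]
  exact inverse_smul_sum_eq_of_const hP h

theorem avg_mul_push_avg [Finite H] (hP : IsUnit (Nat.card P : 𝕜)) {Q : AddSubgroup H} {f : G →+ H}
    (hf : ∀ t ∈ P, f t ∈ Q) : avg 𝕜 Q * push 𝕜 f (avg 𝕜 P) = avg 𝕜 Q := by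
  rw [mul_comm]
  nth_rw 1 [avg]
  rw [map_smul, map_sum, smul_mul_assoc, Finset.sum_mul]
  refine inverse_smul_sum_eq_of_const hP fun t ht => ?_
  rw [push_single, single_mul_avg (hf t ht)]

theorem push_avg_eq (hP : IsUnit (Nat.card P : 𝕜)) {f : G →+ G} (hf : ∀ t ∈ P, f t ∈ P)
    (hf' : ∀ t ∈ P, ∃ s ∈ P, f s = t) : push 𝕜 f (avg 𝕜 P) = avg 𝕜 P := by
  refine (avg_mul_of_absorbs hP fun t ht => ?_).symm.trans (avg_mul_push_avg hP hf)
  obtain ⟨s, hs, rfl⟩ := hf' t ht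
  rw [← push_single, ← map_mul, single_mul_avg hs]

theorem avg_mul_single_eq {x y : G} (h : x - y ∈ P) :
    avg 𝕜 P * single x 1 = avg 𝕜 P * single y 1 := by
  have : single x (1 : 𝕜) = single (x - y) 1 * single y 1 := by simp [single_mul_single]
  rw [this, ← mul_assoc, mul_comm (avg 𝕜 P), single_mul_avg h]

/-- The kernel of f lies in P, so multiplication by the average factors through `push 𝕜 f`; the map
L is the other factor. -/
theorem avg_mul_eq_zero_of_push_eq_zero {f : G →+ H} (hf : Function.Surjective f)
    (hker : ∀ x, f x = 0 → x ∈ P) {w : AddMonoidAlgebra 𝕜 G} (hw : push 𝕜 f w = 0) :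
    avg 𝕜 P * w = 0 := by
  let L : AddMonoidAlgebra 𝕜 H →ₗ[𝕜] AddMonoidAlgebra 𝕜 G :=
    Finsupp.lsum 𝕜 (fun z => LinearMap.toSpanSingleton 𝕜 _
      (avg 𝕜 P * single (Function.surjInv hf z) 1)) ∘ₗ
        (AddMonoidAlgebra.coeffLinearEquiv 𝕜).toLinearMap
  have hL : L ∘ₗ (push 𝕜 f).toLinearMap = LinearMap.mulLeft 𝕜 (avg 𝕜 P) := by
    refine linearMap_ext fun x => ?_
    simp only [LinearMap.comp_apply, AlgHom.toLinearMap_apply, push_single, L,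
      LinearMap.mulLeft_apply]
    simp
    refine avg_mul_single_eq (hker _ ?_)
    rw [map_sub, Function.surjInv_eq hf, sub_self]
  have := LinearMap.congr_fun hL w
  simpa [hw] using this.symm

theorem sum_coeff_add_eq_zero (hP : IsUnit (Nat.card P : 𝕜)) {c : AddMonoidAlgebra 𝕜 G}
    (h : avg 𝕜 P * c = 0) (b : G) :
    ∑ t ∈ (Set.toFinite (P : Set G)).toFinset, c.coeff (b + t) = 0 := by
  have h1 : (∑ t ∈ (Set.toFinite (P : Set G)).toFinset, single t (1 : 𝕜)) * c = 0 := by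
    have := congrArg ((Nat.card P : 𝕜) • ·) h
    simpa [avg, smul_smul, Ring.mul_inverse_cancel _ hP] using this
  have h2 := congrArg (fun w => w.coeff b) h1
  rw [Finset.sum_mul] at h2
  simp at h2
  rw [← h2]
  refine Finset.sum_bij' (fun s _ => -s) (fun s _ => -s) ?_ ?_ ?_ ?_ ?_
  all_goals simp [add_comm]

end AddMonoidAlgebra

/-! ### Finite distributive modules: cyclicity and minimal submodules -/

section Distributive

variable {R A : Type*} [Ring R] [AddCommGroup A] [Module R A]

namespace IsDistributiveModule

theorem of_injective {A' : Type*} [AddCommGroup A'] [Module R A'] (hA : IsDistributiveModule R A)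
    {f : A' →ₗ[R] A} (hf : Function.Injective f) : IsDistributiveModule R A' := by
  intro X Y Z
  apply Submodule.map_injective_of_injective hf
  rw [Submodule.map_sup, Submodule.map_inf _ hf, Submodule.map_inf _ hf, Submodule.map_inf _ hf,
    Submodule.map_sup]
  exact hA _ _ _

theorem of_surjective {A' : Type*} [AddCommGroup A'] [Module R A'] (hA : IsDistributiveModule R A)
    {f : A →ₗ[R] A'} (hf : Function.Surjective f) : IsDistributiveModule R A' := by
  intro X Y Z
  refine le_antisymm ?_ le_inf_sup
  rintro a ⟨haX, haYZ⟩
  obtain ⟨y, hy, z, hz, rfl⟩ := Submodule.mem_sup.1 haYZ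
  obtain ⟨y, rfl⟩ := hf y
  obtain ⟨z, rfl⟩ := hf z
  have : y + z ∈ X.comap f ⊓ (Y.comap f ⊔ Z.comap f) :=
    ⟨by simpa using haX, Submodule.add_mem_sup hy hz⟩
  rw [hA] at this
  obtain ⟨p, hp, q, hq, hpq⟩ := Submodule.mem_sup.1 this
  rw [← map_add, ← hpq, map_add]
  exact Submodule.add_mem_sup ⟨hp.1, hp.2⟩ ⟨hq.1, hq.2⟩

theorem sup_inf (hA : IsDistributiveModule R A) (X Y Z : Submodule R A) :
    X ⊔ (Y ⊓ Z) = (X ⊔ Y) ⊓ (X ⊔ Z) := by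
  rw [hA, inf_comm (X ⊔ Y) X, inf_sup_self, inf_comm (X ⊔ Y) Z, hA, inf_comm Z X, inf_comm Z Y,
    ← sup_assoc, sup_inf_self]

/-- An element outside all maximal submodules generates. As in prime avoidance, g is corrected for
one maximal submodule at a time by an element of all the earlier ones. -/
theorem exists_span_singleton_eq_top [Finite A] (hA : IsDistributiveModule R A) :
    ∃ g : A, Submodule.span R {g} = ⊤ := by
  classical
  have key : ∀ I : Finset (Submodule R A), (∀ M ∈ I, IsCoatom M) → ∃ g : A, ∀ M ∈ I, g ∉ M := by
    intro I
    induction I using Finset.induction_on with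
    | empty => exact fun _ => ⟨0, by simp⟩
    | insert M I hM ih =>
      intro h
      obtain ⟨g, hg⟩ := ih fun N hN => h N (Finset.mem_insert_of_mem hN)
      have hMc := h M (Finset.mem_insert_self _ _)
      by_cases hgM : g ∈ M
      -- Distributivity makes maximal submodules behave like primes: one that contains a finite
      -- intersection of others would equal one of them.
      · have hle : ∀ J ⊆ I, ¬ J.inf id ≤ M := by
          intro J
          induction J using Finset.induction_on with
          | empty => exact fun _ hle => hMc.1 (top_le_iff.1 (by simpa using hle))
          | insert N J hN ihJ =>
            intro hJ hle
            have hNI := hJ (Finset.mem_insert_self _ _)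
            rw [Finset.inf_insert, id] at hle
            have h1 : M = (M ⊔ N) ⊓ (M ⊔ J.inf id) := by
              rw [← hA.sup_inf, sup_eq_left.2 hle]
            have h2 : M ⊔ J.inf id = ⊤ := hMc.2 _ (left_lt_sup.2
              (ihJ fun K hK => hJ (Finset.mem_insert_of_mem hK)))
            rw [h2, inf_top_eq] at h1
            have h3 : N ≤ M := by rw [h1]; exact le_sup_right
            rcases (h N (Finset.mem_insert_of_mem hNI)).le_iff.1 h3 with h4 | h4
            · exact hMc.1 h4
            · exact hM (h4 ▸ hNI)
        obtain ⟨a, ha, haM⟩ := SetLike.not_le_iff_exists.1 (hle I subset_rfl)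
        refine ⟨g + a, fun N hN => ?_⟩
        rcases Finset.mem_insert.1 hN with rfl | hN
        · exact fun hmem => haM ((N.add_mem_iff_right hgM).1 hmem)
        · have haN : a ∈ N := (Finset.inf_le (f := id) hN) ha
          exact fun hmem => hg N hN ((N.add_mem_iff_left haN).1 hmem)
      · refine ⟨g, fun N hN => ?_⟩
        rcases Finset.mem_insert.1 hN with rfl | hN
        · exact hgM
        · exact hg N hN
  have : Finite (Submodule R A) := Finite.of_injective _ SetLike.coe_injective
  obtain ⟨g, hg⟩ := key (Set.toFinite {M : Submodule R A | IsCoatom M}).toFinset (by simp)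
  refine ⟨g, by_contra fun h => ?_⟩
  obtain ⟨M, hM, hgM⟩ := (eq_top_or_exists_le_coatom (Submodule.span R {g})).resolve_left h
  exact hg M (by simpa using hM) (hgM (Submodule.mem_span_singleton_self g))

/-- If T and φ T differ, the diagonal {t + φ t} meets both trivially but lies in their sum;
distributivity makes it zero, so φ t = -t lies in T. -/
theorem map_eq_of_isAtom (hA : IsDistributiveModule R A) {T : Submodule R A} (hT : IsAtom T)
    (φ : A ≃ₗ[R] A) : T.map (φ : A →ₗ[R] A) = T := by
  have hφT : IsAtom (T.map (φ : A →ₗ[R] A)) := by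
    simpa using (Submodule.orderIsoMapComap φ).isAtom_iff T |>.2 hT
  by_contra hne
  have hdisj : T ⊓ T.map (φ : A →ₗ[R] A) = ⊥ :=
    (hT.disjoint_of_ne hφT fun h => hne h.symm).eq_bot
  have hzero : ∀ t ∈ T, t = 0 := by
    intro t ht
    let D : Submodule R A := T.map (LinearMap.id + (φ : A →ₗ[R] A))
    have hD : ∀ t ∈ T, t + φ t = 0 := by
      intro t ht
      have htD : t + φ t ∈ D ⊓ (T ⊔ T.map (φ : A →ₗ[R] A)) :=
        ⟨⟨t, ht, by simp⟩, Submodule.add_mem_sup ht ⟨t, ht, rfl⟩⟩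
      rw [hA] at htD
      have h1 : D ⊓ T = ⊥ := by
        refine (Submodule.eq_bot_iff _).2 ?_
        rintro _ ⟨⟨s, hs, rfl⟩, hsT⟩
        have : φ s ∈ T := (T.add_mem_iff_right hs).1 (by simpa using hsT)
        have : φ s ∈ T ⊓ T.map (φ : A →ₗ[R] A) := ⟨this, s, hs, rfl⟩
        rw [hdisj, Submodule.mem_bot] at this
        have hs0 : s = 0 := by simpa using this
        simp [hs0]
      have h2 : D ⊓ T.map (φ : A →ₗ[R] A) = ⊥ := by
        refine (Submodule.eq_bot_iff _).2 ?_
        rintro _ ⟨⟨s, hs, rfl⟩, hsT⟩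
        have h3 : s ∈ T.map (φ : A →ₗ[R] A) :=
          ((T.map (φ : A →ₗ[R] A)).add_mem_iff_left ⟨s, hs, rfl⟩).1 hsT
        have : s ∈ T ⊓ T.map (φ : A →ₗ[R] A) := ⟨hs, h3⟩
        rw [hdisj, Submodule.mem_bot] at this
        simp [this]
      simpa [h1, h2] using htD
    have h3 : φ t ∈ T := by
      rw [← neg_eq_of_add_eq_zero_right (hD t ht)]
      exact T.neg_mem ht
    have : φ t ∈ T ⊓ T.map (φ : A →ₗ[R] A) := ⟨h3, t, ht, rfl⟩
    rw [hdisj, Submodule.mem_bot] at this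
    simpa using this
  exact hT.1 ((Submodule.eq_bot_iff _).2 hzero)

/-- An atom that is not contained in some maximal submodule is complemented by it, and that
maximal submodule contains all other atoms. -/
theorem isCompl_of_not_le (hA : IsDistributiveModule R A) {T M : Submodule R A} (hT : IsAtom T)
    (hM : IsCoatom M) (h : ¬ T ≤ M) :
    IsCompl T M ∧ ∀ T', IsAtom T' → T' ≠ T → T' ≤ M := by
  have hc : IsCompl T M := ⟨(hT.not_le_iff_disjoint).1 h, codisjoint_iff.2 <| by
    rw [sup_comm]; exact hM.2 _ (left_lt_sup.2 h)⟩
  refine ⟨hc, fun T' hT' hne => ?_⟩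
  have h1 : T' ⊓ (T ⊔ M) = T' := by rw [hc.sup_eq_top, inf_top_eq]
  rw [hA, (hT'.disjoint_of_ne hT hne).eq_bot, bot_sup_eq] at h1
  exact inf_eq_left.1 h1

end IsDistributiveModule

end Distributive

open AddMonoidAlgebra (push avg)

/-! ### Matrices acting on formal combinations of tuples -/

section Tuples

variable {𝕜 R A A' : Type*} [Ring R] [AddCommGroup A] [Module R A] [AddCommGroup A'] [Module R A']
  [CommRing 𝕜] {k l m n r : ℕ}

/-- The action of a matrix over `R` on tuples of elements of an `R`-module. -/
def Matrix.tupleHom (A : Type*) [AddCommGroup A] [Module R A] (M : Matrix (Fin m) (Fin n) R) :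
    (Fin n → A) →+ (Fin m → A) where
  toFun x i := ∑ j, M i j • x j
  map_zero' := by ext; simp
  map_add' x y := by ext; simp [Finset.sum_add_distrib]

theorem Matrix.tupleHom_apply (M : Matrix (Fin m) (Fin n) R) (x : Fin n → A) (i : Fin m) :
    M.tupleHom A x i = ∑ j, M i j • x j := rfl

theorem Matrix.tupleHom_mul (M : Matrix (Fin l) (Fin m) R) (N : Matrix (Fin m) (Fin n) R)
    (x : Fin n → A) : (M * N).tupleHom A x = M.tupleHom A (N.tupleHom A x) := by
  ext i
  simp only [Matrix.tupleHom_apply, Matrix.mul_apply, Finset.smul_sum, Finset.sum_smul, mul_smul]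
  exact Finset.sum_comm

theorem Matrix.tupleHom_one (x : Fin n → A) : (1 : Matrix (Fin n) (Fin n) R).tupleHom A x = x := by
  ext i
  simp [Matrix.tupleHom_apply, Matrix.one_apply, ite_smul]

/-- The coordinatewise application of a linear map to tuples. -/
def LinearMap.tupleMap (n : ℕ) (φ : A →ₗ[R] A') : (Fin n → A) →+ (Fin n → A') where
  toFun x i := φ (x i)
  map_zero' := by ext; simp
  map_add' x y := by ext; simp

@[simp] theorem LinearMap.tupleMap_apply (φ : A →ₗ[R] A') (x : Fin n → A) (i : Fin n) :
    φ.tupleMap n x i = φ (x i) := rfl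

theorem Matrix.tupleHom_tupleMap (M : Matrix (Fin m) (Fin n) R) (φ : A →ₗ[R] A') (x : Fin n → A) :
    M.tupleHom A' (φ.tupleMap n x) = φ.tupleMap m (M.tupleHom A x) := by
  ext i
  simp [Matrix.tupleHom_apply]

/-- The tuples with entries in a submodule. -/
def Submodule.tuples (n : ℕ) (T : Submodule R A) : AddSubgroup (Fin n → A) where
  carrier := {x | ∀ i, x i ∈ T}
  zero_mem' _ := T.zero_mem
  add_mem' hx hy i := T.add_mem (hx i) (hy i)
  neg_mem' hx i := T.neg_mem (hx i)

theorem Submodule.mem_tuples {T : Submodule R A} {x : Fin n → A} :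
    x ∈ T.tuples n ↔ ∀ i, x i ∈ T := Iff.rfl

theorem Submodule.tupleHom_mem_tuples {T : Submodule R A} (M : Matrix (Fin m) (Fin n) R)
    {x : Fin n → A} (hx : x ∈ T.tuples n) : M.tupleHom A x ∈ T.tuples m :=
  fun i => T.sum_mem (t := Finset.univ) fun j _ => T.smul_mem (M i j) (hx j)

theorem isUnit_natCard_tuples [Finite A] (hA : IsUnit (Nat.card A : 𝕜)) (T : Submodule R A) :
    IsUnit (Nat.card (T.tuples n) : 𝕜) := by
  refine AddMonoidAlgebra.isUnit_natCard_subgroup ?_ _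
  rw [Nat.card_fun, Nat.cast_pow]
  exact hA.pow _

variable (𝕜 R A) in
/-- The action of the algebra of formal combinations of matrices on formal combinations of
tuples. -/
noncomputable def tupleAct (k : ℕ) : MonoidAlgebra 𝕜 (Matrix (Fin k) (Fin k) R) →ₐ[𝕜]
    Module.End 𝕜 (AddMonoidAlgebra 𝕜 (Fin k → A)) :=
  MonoidAlgebra.lift 𝕜 _ _
    { toFun := fun M => (push 𝕜 (M.tupleHom A)).toLinearMap
      map_one' := AddMonoidAlgebra.linearMap_ext fun x => by simp [Matrix.tupleHom_one]
      map_mul' := fun M N => AddMonoidAlgebra.linearMap_ext fun x => by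
        simp [Matrix.tupleHom_mul] }

@[simp] theorem tupleAct_single (M : Matrix (Fin k) (Fin k) R) (s : 𝕜)
    (w : AddMonoidAlgebra 𝕜 (Fin k → A)) :
    tupleAct 𝕜 R A k (MonoidAlgebra.single M s) w = s • push 𝕜 (M.tupleHom A) w := by
  simp [tupleAct, MonoidAlgebra.lift_single]

/-- Matrices commute with module homomorphisms; this transfers identities from submodules and
quotients to A. -/
theorem push_tupleMap_tupleAct (φ : A →ₗ[R] A') (κ : MonoidAlgebra 𝕜 (Matrix (Fin k) (Fin k) R))
    (w : AddMonoidAlgebra 𝕜 (Fin k → A)) :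
    push 𝕜 (φ.tupleMap k) (tupleAct 𝕜 R A k κ w) =
      tupleAct 𝕜 R A' k κ (push 𝕜 (φ.tupleMap k) w) := by
  induction κ using MonoidAlgebra.induction_linear with
  | zero => simp
  | add κ₁ κ₂ h₁ h₂ => simp [h₁, h₂]
  | single M s =>
    rw [tupleAct_single, tupleAct_single, map_smul, AddMonoidAlgebra.push_push,
      AddMonoidAlgebra.push_push]
    congr 2
    congr 1
    exact AddMonoidHom.ext fun x => (M.tupleHom_tupleMap φ x).symm

variable (𝕜 R) in
/-- The span of the `k × k` matrices that factor through `R ^ r`. -/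
noncomputable def rankSpan (r k : ℕ) : Submodule 𝕜 (MonoidAlgebra 𝕜 (Matrix (Fin k) (Fin k) R)) :=
  Submodule.span 𝕜 {κ | ∃ (v : Matrix (Fin k) (Fin r) R) (h : Matrix (Fin r) (Fin k) R),
    κ = MonoidAlgebra.single (v * h) 1}

theorem single_mem_rankSpan (v : Matrix (Fin k) (Fin r) R) (h : Matrix (Fin r) (Fin k) R) (s : 𝕜) :
    MonoidAlgebra.single (v * h) s ∈ rankSpan 𝕜 R r k := by
  have : MonoidAlgebra.single (v * h) s = s • MonoidAlgebra.single (v * h) (1 : 𝕜) := by simp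
  rw [this]
  exact Submodule.smul_mem _ _ (Submodule.subset_span ⟨v, h, rfl⟩)

theorem mul_mem_rankSpan {κ κ' : MonoidAlgebra 𝕜 (Matrix (Fin k) (Fin k) R)}
    (h : κ ∈ rankSpan 𝕜 R r k) (h' : κ' ∈ rankSpan 𝕜 R r k) : κ * κ' ∈ rankSpan 𝕜 R r k := by
  have := Submodule.mul_mem_mul h h'
  rw [rankSpan, Submodule.span_mul_span] at this
  refine Submodule.span_mono ?_ this
  rintro _ ⟨_, ⟨v, h, rfl⟩, _, ⟨v', h', rfl⟩, rfl⟩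
  exact ⟨v, h * (v' * h'), by simp [MonoidAlgebra.single_mul_single, Matrix.mul_assoc]⟩

theorem exists_one_sub_mul_one_sub {κ κ' : MonoidAlgebra 𝕜 (Matrix (Fin k) (Fin k) R)}
    (h : κ ∈ rankSpan 𝕜 R r k) (h' : κ' ∈ rankSpan 𝕜 R r k) :
    ∃ κ'' ∈ rankSpan 𝕜 R r k, 1 - κ'' = (1 - κ) * (1 - κ') :=
  ⟨κ + κ' - κ * κ', sub_mem (add_mem h h') (mul_mem_rankSpan h h'), by noncomm_ring⟩

variable (𝕜 R A) in
/-- Some formal combination of matrices of rank at most `r` acts as the identity on `k`-tuples. -/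
def RankIdentity (r k : ℕ) : Prop :=
  ∃ κ ∈ rankSpan 𝕜 R r k, tupleAct 𝕜 R A k (1 - κ) = 0

variable (𝕜 R A) in
/-- The span of the tuples that do not generate the module. -/
noncomputable def nonGenerating (n : ℕ) : Submodule 𝕜 (AddMonoidAlgebra 𝕜 (Fin n → A)) :=
  Submodule.span 𝕜 {w | ∃ y : Fin n → A, Submodule.span R (Set.range y) ≠ ⊤ ∧
    w = AddMonoidAlgebra.single y 1}

theorem single_mem_nonGenerating {y : Fin n → A} (hy : Submodule.span R (Set.range y) ≠ ⊤) :
    AddMonoidAlgebra.single y 1 ∈ nonGenerating 𝕜 R A n :=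
  Submodule.subset_span ⟨y, hy, rfl⟩

/-- A non-generating tuple lives in the proper submodule X that it spans; the product of the factors
1 - κ for all proper X kills all such tuples at once. -/
theorem exists_rankSpan_vanishing_on_nonGenerating [Finite A]
    (h : ∀ X : Submodule R A, X ≠ ⊤ → RankIdentity 𝕜 R X r k) :
    ∃ κ ∈ rankSpan 𝕜 R r k, ∀ w ∈ nonGenerating 𝕜 R A k, tupleAct 𝕜 R A k (1 - κ) w = 0 := by
  classical
  have key : ∀ I : Finset (Submodule R A), (∀ X ∈ I, X ≠ ⊤) → ∃ κ ∈ rankSpan 𝕜 R r k,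
      ∀ X ∈ I, tupleAct 𝕜 R X k (1 - κ) = 0 := by
    intro I
    induction I using Finset.induction_on with
    | empty => exact fun _ => ⟨0, zero_mem _, by simp⟩
    | insert X I _ ih =>
      intro hI
      obtain ⟨κ, hκ, hκI⟩ := ih fun Y hY => hI Y (Finset.mem_insert_of_mem hY)
      obtain ⟨κX, hκX, hX⟩ := h X (hI X (Finset.mem_insert_self _ _))
      obtain ⟨κ', hκ', he⟩ := exists_one_sub_mul_one_sub hκX hκ
      refine ⟨κ', hκ', fun Y hY => ?_⟩
      rw [he, map_mul]
      rcases Finset.mem_insert.1 hY with rfl | hY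
      · rw [hX, zero_mul]
      · rw [hκI Y hY, mul_zero]
  have : Finite (Submodule R A) := Finite.of_injective _ SetLike.coe_injective
  obtain ⟨κ, hκ, hκI⟩ := key (Set.toFinite {X : Submodule R A | X ≠ ⊤}).toFinset (by simp)
  refine ⟨κ, hκ, fun w hw => ?_⟩
  suffices hle : nonGenerating 𝕜 R A k ≤ LinearMap.ker (tupleAct 𝕜 R A k (1 - κ)) from hle hw
  refine Submodule.span_le.2 ?_
  rintro _ ⟨y, hy, rfl⟩
  have h1 : AddMonoidAlgebra.single y (1 : 𝕜) =
      push 𝕜 ((Submodule.span R (Set.range y)).subtype.tupleMap k)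
        (AddMonoidAlgebra.single (fun i => ⟨y i, Submodule.subset_span ⟨i, rfl⟩⟩) 1) := by
    rw [AddMonoidAlgebra.push_single]
    rfl
  rw [SetLike.mem_coe, LinearMap.mem_ker, h1, ← push_tupleMap_tupleAct, hκI _ (by simpa using hy)]
  simp

/-- What vanishes over A/T is killed by averaging over T; again the factors 1 - κ for the single T
are multiplied. -/
theorem exists_rankSpan_vanishing_mod_atoms [Finite A]
    (h : ∀ T : Submodule R A, IsAtom T → RankIdentity 𝕜 R (A ⧸ T) r k) :
    ∃ κ ∈ rankSpan 𝕜 R r k, ∀ w, ∀ T : Submodule R A, IsAtom T →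
      avg 𝕜 (T.tuples k) * tupleAct 𝕜 R A k (1 - κ) w = 0 := by
  classical
  have key : ∀ I : Finset (Submodule R A), (∀ T ∈ I, IsAtom T) → ∃ κ ∈ rankSpan 𝕜 R r k,
      ∀ T ∈ I, tupleAct 𝕜 R (A ⧸ T) k (1 - κ) = 0 := by
    intro I
    induction I using Finset.induction_on with
    | empty => exact fun _ => ⟨0, zero_mem _, by simp⟩
    | insert X I _ ih =>
      intro hI
      obtain ⟨κ, hκ, hκI⟩ := ih fun Y hY => hI Y (Finset.mem_insert_of_mem hY)
      obtain ⟨κX, hκX, hX⟩ := h X (hI X (Finset.mem_insert_self _ _))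
      obtain ⟨κ', hκ', he⟩ := exists_one_sub_mul_one_sub hκX hκ
      refine ⟨κ', hκ', fun Y hY => ?_⟩
      rw [he, map_mul]
      rcases Finset.mem_insert.1 hY with rfl | hY
      · rw [hX, zero_mul]
      · rw [hκI Y hY, mul_zero]
  have : Finite (Submodule R A) := Finite.of_injective _ SetLike.coe_injective
  obtain ⟨κ, hκ, hκI⟩ := key (Set.toFinite {T : Submodule R A | IsAtom T}).toFinset (by simp)
  refine ⟨κ, hκ, fun w T hT => ?_⟩
  refine AddMonoidAlgebra.avg_mul_eq_zero_of_push_eq_zero (f := T.mkQ.tupleMap k) ?_ ?_ ?_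
  · intro z
    choose a ha using fun i => T.mkQ_surjective (z i)
    exact ⟨a, funext ha⟩
  · intro x hx i
    simpa using congrFun hx i
  · rw [push_tupleMap_tupleAct, hκI T (by simpa using hT), LinearMap.zero_apply]

end Tuples

/-! ### Interpolation on the automorphism orbit of a generating tuple -/

section Interpolation

variable {𝕜 R A : Type*} [Ring R] [AddCommGroup A] [Module R A] [CommRing 𝕜] {k n r : ℕ}

/-- A tuple that satisfies only linear relations valid for a generating tuple is its image under
an automorphism, provided that the module is finite. -/
theorem exists_linearEquiv_of_relations [Finite A] {x y : Fin k → A}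
    (hx : Submodule.span R (Set.range x) = ⊤)
    (h : ∀ l : Fin k → R, ∑ i, l i • y i = 0 → ∑ i, l i • x i = 0) :
    ∃ φ : A ≃ₗ[R] A, y = (φ : A →ₗ[R] A).tupleMap k x := by
  let X := Fintype.linearCombination R x
  let Y := Fintype.linearCombination R y
  have hle : LinearMap.ker Y ≤ LinearMap.ker X := by
    intro l hl
    simp only [LinearMap.mem_ker, X, Y, Fintype.linearCombination_apply] at hl ⊢
    exact h l hl
  let p := (LinearMap.ker Y).liftQ Y le_rfl
  let q := (LinearMap.ker Y).liftQ X hle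
  have hp : Function.Injective p := by
    rw [← LinearMap.ker_eq_bot]
    exact Submodule.ker_liftQ_eq_bot _ _ _ le_rfl
  have hq : Function.Surjective q := by
    rw [← LinearMap.range_eq_top, Submodule.range_liftQ, Fintype.range_linearCombination, hx]
  -- The quotient embeds into A by p and maps onto A by q; since A is finite, both are bijective.
  have : Finite ((Fin k → R) ⧸ LinearMap.ker Y) := Finite.of_injective p hp
  have hp' := hp.bijective_of_nat_card_le (Nat.card_le_card_of_surjective q hq)
  have hq' := hq.bijective_of_nat_card_le (Nat.card_le_card_of_injective p hp)
  refine ⟨(LinearEquiv.ofBijective q hq').symm ≪≫ₗ LinearEquiv.ofBijective p hp', ?_⟩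
  ext i
  have hxi : (LinearEquiv.ofBijective q hq').symm (x i) =
      (LinearMap.ker Y).mkQ (Pi.single i 1) := by
    rw [LinearEquiv.symm_apply_eq]
    simp [q, X, Fintype.linearCombination_apply, Pi.single_apply, ite_smul]
  simp [hxi, p, Y, Fintype.linearCombination_apply, Pi.single_apply, ite_smul]

theorem sum_comp_of_surjective {G H V : Type*} [AddCommGroup G] [Fintype G] [AddCommGroup H]
    [Fintype H] [AddCommMonoid V] {f : G →+ H} (hf : Function.Surjective f) (F : H → V) :
    ∑ g, F (f g) = Nat.card f.ker • ∑ b, F b := by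
  classical
  rw [← Finset.sum_fiberwise_of_maps_to (s := Finset.univ) (t := Finset.univ) (g := f)
    (fun _ _ => Finset.mem_univ _), Finset.smul_sum]
  refine Finset.sum_congr rfl fun b _ => ?_
  rw [Finset.sum_congr rfl (g := fun _ => F b) (by simp +contextual), Finset.sum_const,
    AddMonoidHom.card_fiber_eq_of_mem_range f (hf b) (hf 0)]
  congr 1
  rw [Nat.card_eq_fintype_card, Fintype.card_subtype]
  simp [AddMonoidHom.mem_ker]

/-- The evaluation of matrices at a tuple. -/
def tupleEval (r : ℕ) (R : Type*) [Ring R] [Module R A] (x : Fin k → A) :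
    Matrix (Fin r) (Fin k) R →+ (Fin r → A) where
  toFun h := h.tupleHom A x
  map_zero' := by ext; simp [Matrix.tupleHom_apply]
  map_add' g h := by ext; simp [Matrix.tupleHom_apply, add_smul, Finset.sum_add_distrib]

theorem tupleEval_apply (x : Fin k → A) (h : Matrix (Fin r) (Fin k) R) :
    tupleEval r R x h = h.tupleHom A x := rfl

theorem tupleEval_surjective {x : Fin k → A} (hx : Submodule.span R (Set.range x) = ⊤) :
    Function.Surjective (tupleEval r R x) := by
  intro b
  have h : ∀ a : A, ∃ l : Fin k → R, ∑ j, l j • x j = a := fun a =>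
    (Submodule.mem_span_range_iff_exists_fun R).1 (hx ▸ Submodule.mem_top)
  choose l hl using h
  exact ⟨fun i => l (b i), funext fun i => hl (b i)⟩

/-- Some relation of y fails for x, so the values at x of the relations of y form a nonzero
submodule K. Shifting the rows of h by such relations fixes h y but moves h x through a coset of T^r
for a minimal T ≤ K, where c sums to zero. -/
theorem sum_single_eq_zero_of_not_exists_linearEquiv [Fintype R] [Finite A]
    (hA : IsUnit (Nat.card A : 𝕜)) {x y : Fin k → A} (hx : Submodule.span R (Set.range x) = ⊤)
    (hy : ¬ ∃ φ : A ≃ₗ[R] A, y = (φ : A →ₗ[R] A).tupleMap k x)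
    {c : AddMonoidAlgebra 𝕜 (Fin r → A)}
    (hc : ∀ T : Submodule R A, IsAtom T → avg 𝕜 (T.tuples r) * c = 0) :
    ∑ h : Matrix (Fin r) (Fin k) R,
      AddMonoidAlgebra.single (h.tupleHom A y) (c.coeff (h.tupleHom A x)) = 0 := by
  have hrel : ∃ l : Fin k → R, ∑ i, l i • y i = 0 ∧ ∑ i, l i • x i ≠ 0 := by
    by_contra! hcon
    exact hy (exists_linearEquiv_of_relations hx hcon)
  let K : Submodule R A := (LinearMap.ker (Fintype.linearCombination R y)).map
    (Fintype.linearCombination R x)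
  have hK : K ≠ ⊥ := by
    obtain ⟨l, hl, hl'⟩ := hrel
    intro hbot
    have : Fintype.linearCombination R x l ∈ K :=
      ⟨l, by simpa [Fintype.linearCombination_apply] using hl, rfl⟩
    rw [hbot, Submodule.mem_bot, Fintype.linearCombination_apply] at this
    exact hl' this
  obtain ⟨T, hT, hTK⟩ := (eq_bot_or_exists_atom_le K).resolve_left hK
  have hlift : ∀ t : Fin r → A, t ∈ T.tuples r → ∃ h : Matrix (Fin r) (Fin k) R,
      h.tupleHom A x = t ∧ h.tupleHom A y = 0 := by
    intro t ht
    choose l hl hlt using fun i => hTK (ht i)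
    refine ⟨l, funext fun i => ?_, funext fun i => ?_⟩
    · exact (Fintype.linearCombination_apply R x (l i)).symm.trans (hlt i)
    · exact (Fintype.linearCombination_apply R y (l i)).symm.trans (hl i)
  let G := ∑ h : Matrix (Fin r) (Fin k) R,
      AddMonoidAlgebra.single (h.tupleHom A y) (c.coeff (h.tupleHom A x))
  have hunit := isUnit_natCard_tuples (n := r) hA T
  have hshift : ∀ t ∈ T.tuples r, ∑ h : Matrix (Fin r) (Fin k) R,
      AddMonoidAlgebra.single (h.tupleHom A y) (c.coeff (h.tupleHom A x + t)) = G := by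
    intro t ht
    obtain ⟨h', hx', hy'⟩ := hlift t ht
    refine Fintype.sum_equiv (Equiv.addRight h') _ _ fun h => ?_
    simp only [Equiv.coe_addRight, ← tupleEval_apply, map_add]
    rw [tupleEval_apply y h', tupleEval_apply x h', hx', hy', add_zero]
  change G = 0
  rw [← AddMonoidAlgebra.inverse_smul_sum_eq_of_const hunit hshift, Finset.sum_comm]
  rw [Finset.sum_eq_zero, smul_zero]
  intro h _
  have h1 := AddMonoidAlgebra.sum_coeff_add_eq_zero hunit (hc T hT) (h.tupleHom A x)
  have h2 : ∀ s : 𝕜, AddMonoidAlgebra.single (h.tupleHom A y) s =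
      s • AddMonoidAlgebra.single (h.tupleHom A y) (1 : 𝕜) := fun s => by simp
  simp only [h2 (AddMonoidAlgebra.coeff _ _), ← Finset.sum_smul, h1, zero_smul]

/-- Interpolation on the orbit of a generating tuple under the automorphism group. -/
theorem exists_rankSpan_interpolation [Finite R] [Finite A] (hR : IsUnit (Nat.card R : 𝕜))
    (hA : IsUnit (Nat.card A : 𝕜)) {x : Fin k → A} (hx : Submodule.span R (Set.range x) = ⊤)
    {c : AddMonoidAlgebra 𝕜 (Fin r → A)}
    (hc : ∀ T : Submodule R A, IsAtom T → avg 𝕜 (T.tuples r) * c = 0)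
    (v : Matrix (Fin k) (Fin r) R) :
    ∃ κ ∈ rankSpan 𝕜 R r k,
      (∀ φ : A ≃ₗ[R] A, tupleAct 𝕜 R A k κ
          (AddMonoidAlgebra.single ((φ : A →ₗ[R] A).tupleMap k x) 1) =
        push 𝕜 (v.tupleHom A) (push 𝕜 ((φ : A →ₗ[R] A).tupleMap r) c)) ∧
      ∀ y, (¬ ∃ φ : A ≃ₗ[R] A, y = (φ : A →ₗ[R] A).tupleMap k x) →
        tupleAct 𝕜 R A k κ (AddMonoidAlgebra.single y 1) = 0 := by
  classical
  have := Fintype.ofFinite R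
  have := Fintype.ofFinite A
  let κ : MonoidAlgebra 𝕜 (Matrix (Fin k) (Fin k) R) :=
    ∑ h : Matrix (Fin r) (Fin k) R, MonoidAlgebra.single (v * h) (c.coeff (h.tupleHom A x))
  have hκ : κ ∈ rankSpan 𝕜 R r k := sum_mem fun h _ => single_mem_rankSpan _ _ _
  have hact : ∀ y : Fin k → A, tupleAct 𝕜 R A k κ (AddMonoidAlgebra.single y 1) =
      push 𝕜 (v.tupleHom A) (∑ h : Matrix (Fin r) (Fin k) R,
        AddMonoidAlgebra.single (h.tupleHom A y) (c.coeff (h.tupleHom A x))) := by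
    intro y
    simp only [κ, map_sum, LinearMap.sum_apply, tupleAct_single, AddMonoidAlgebra.push_single]
    refine Finset.sum_congr rfl fun h _ => ?_
    rw [Matrix.tupleHom_mul]
    simp
  have hunit : IsUnit (Nat.card (tupleEval r R x).ker : 𝕜) := by
    refine AddMonoidAlgebra.isUnit_natCard_subgroup ?_ _
    rw [show Nat.card (Matrix (Fin r) (Fin k) R) = Nat.card (Fin r → Fin k → R) from rfl,
      Nat.card_fun, Nat.card_fun, Nat.cast_pow, Nat.cast_pow]
    exact (hR.pow _).pow _
  -- Each value h x is attained equally often, namely by as many h as the kernel of evaluation at x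
  -- has elements.
  refine ⟨Ring.inverse (Nat.card (tupleEval r R x).ker : 𝕜) • κ, Submodule.smul_mem _ _ hκ,
    fun φ => ?_, fun y hy => ?_⟩
  · rw [map_smul, LinearMap.smul_apply, hact, ← map_smul]
    congr 1
    simp only [Matrix.tupleHom_tupleMap]
    have h1 := sum_comp_of_surjective (tupleEval_surjective (r := r) hx)
      fun b => AddMonoidAlgebra.single ((φ : A →ₗ[R] A).tupleMap r b) (c.coeff b)
    simp only [tupleEval_apply] at h1
    rw [h1, ← Nat.cast_smul_eq_nsmul 𝕜, smul_smul, Ring.inverse_mul_cancel _ hunit, one_smul]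
    have h2 : c = ∑ b, AddMonoidAlgebra.single b (c.coeff b) := by
      ext b
      simp [AddMonoidAlgebra.coeff_sum]
    conv_rhs => rw [h2, map_sum]
    simp
  · rw [map_smul, LinearMap.smul_apply, hact,
      sum_single_eq_zero_of_not_exists_linearEquiv hA hx hy hc, map_zero, smul_zero]

end Interpolation

/-! ### Calculations modulo non-generating tuples -/

section NonGenerating

variable {𝕜 R A : Type*} [Ring R] [AddCommGroup A] [Module R A] [CommRing 𝕜] {k m n r : ℕ}

theorem tuples_span_ne_top {M : Submodule R A} (hM : M ≠ ⊤) {y : Fin n → A}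
    (hy : y ∈ M.tuples n) : Submodule.span R (Set.range y) ≠ ⊤ := by
  intro h
  refine hM (top_le_iff.1 (h ▸ Submodule.span_le.2 ?_))
  rintro _ ⟨i, rfl⟩
  exact hy i

theorem mem_tuples_span_range (y : Fin n → A) :
    y ∈ (Submodule.span R (Set.range y)).tuples n :=
  fun i => Submodule.subset_span ⟨i, rfl⟩

theorem push_mem_nonGenerating {f : (Fin m → A) →+ (Fin n → A)}
    (hf : ∀ y, Submodule.span R (Set.range y) ≠ ⊤ → Submodule.span R (Set.range (f y)) ≠ ⊤)
    {w : AddMonoidAlgebra 𝕜 (Fin m → A)} (hw : w ∈ nonGenerating 𝕜 R A m) :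
    push 𝕜 f w ∈ nonGenerating 𝕜 R A n := by
  suffices h : nonGenerating 𝕜 R A m ≤ (nonGenerating 𝕜 R A n).comap (push 𝕜 f).toLinearMap from
    h hw
  refine Submodule.span_le.2 ?_
  rintro _ ⟨y, hy, rfl⟩
  simpa using single_mem_nonGenerating (𝕜 := 𝕜) (hf y hy)

theorem push_tupleHom_mem_nonGenerating (v : Matrix (Fin n) (Fin m) R)
    {w : AddMonoidAlgebra 𝕜 (Fin m → A)} (hw : w ∈ nonGenerating 𝕜 R A m) :
    push 𝕜 (v.tupleHom A) w ∈ nonGenerating 𝕜 R A n :=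
  push_mem_nonGenerating (fun y hy => tuples_span_ne_top hy
    (Submodule.tupleHom_mem_tuples v (mem_tuples_span_range y))) hw

theorem span_range_tupleMap_equiv (φ : A ≃ₗ[R] A) (y : Fin n → A) :
    Submodule.span R (Set.range ((φ : A →ₗ[R] A).tupleMap n y)) = ⊤ ↔
      Submodule.span R (Set.range y) = ⊤ := by
  have h : Set.range ((φ : A →ₗ[R] A).tupleMap n y) = (φ : A →ₗ[R] A) '' Set.range y := by
    rw [← Set.range_comp]
    rfl
  rw [h, ← Submodule.map_span]
  constructor
  · intro h
    apply Submodule.map_injective_of_injective φ.injective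
    rw [h]
    simp
  · intro h
    rw [h]
    simp

theorem push_tupleMap_mem_nonGenerating (φ : A ≃ₗ[R] A)
    {w : AddMonoidAlgebra 𝕜 (Fin m → A)} (hw : w ∈ nonGenerating 𝕜 R A m) :
    push 𝕜 ((φ : A →ₗ[R] A).tupleMap m) w ∈ nonGenerating 𝕜 R A m :=
  push_mem_nonGenerating (fun y hy h => hy ((span_range_tupleMap_equiv φ y).1 h)) hw

/-- Changing coefficients at non-generating tuples only, one achieves that the sums over the cosets
of every minimal submodule vanish, if they do so for the minimal submodules in the radical. -/
theorem IsDistributiveModule.exists_avg_mul_eq_zero [Finite A] (hA : IsDistributiveModule R A)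
    (hAu : IsUnit (Nat.card A : 𝕜)) {c : AddMonoidAlgebra 𝕜 (Fin r → A)}
    (hc : ∀ T : Submodule R A, IsAtom T → (∀ M, IsCoatom M → T ≤ M) →
      avg 𝕜 (T.tuples r) * c = 0) :
    ∃ c', (∀ T : Submodule R A, IsAtom T → avg 𝕜 (T.tuples r) * c' = 0) ∧
      c' - c ∈ nonGenerating 𝕜 R A r := by
  classical
  -- Minimal submodules outside the radical are treated one by one, keeping the vanishing already
  -- achieved.
  have key : ∀ I : Finset (Submodule R A), ∃ c', (∀ T : Submodule R A, IsAtom T →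
      (T ∈ I ∨ ∀ M, IsCoatom M → T ≤ M) → avg 𝕜 (T.tuples r) * c' = 0) ∧
      c' - c ∈ nonGenerating 𝕜 R A r := by
    intro I
    induction I using Finset.induction_on with
    | empty => exact ⟨c, fun T hT h => hc T hT (by simpa using h), by simp⟩
    | insert T I _ ih =>
      obtain ⟨c', hc', hcc'⟩ := ih
      by_cases hT : IsAtom T ∧ ∃ M, IsCoatom M ∧ ¬ T ≤ M
      swap
      · refine ⟨c', fun T' hT' h => hc' T' hT' ?_, hcc'⟩
        rcases h with h | h
        · rcases Finset.mem_insert.1 h with rfl | h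
          · right
            by_contra! hcon
            exact hT ⟨hT', hcon⟩
          · exact Or.inl h
        · exact Or.inr h
      obtain ⟨hT, M, hM, hTM⟩ := hT
      obtain ⟨hcompl, hother⟩ := hA.isCompl_of_not_le hT hM hTM
      let π : A →ₗ[R] A := Submodule.projection M T hcompl.symm
      have hπM : ∀ a, π a ∈ M := fun a => Submodule.projection_apply_mem hcompl.symm a
      have hπid : ∀ a ∈ M, π a = a := fun a ha =>
        Submodule.projection_apply_left hcompl.symm ⟨a, ha⟩
      have hπT : ∀ a, a - π a ∈ T := by
        intro a
        have h0 : π (a - π a) = 0 := by rw [map_sub, hπid _ (hπM a), sub_self]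
        exact (Submodule.projection_apply_eq_zero_iff hcompl.symm).1 h0
      have hpush : ∀ w, push 𝕜 (π.tupleMap r) w ∈ nonGenerating 𝕜 R A r := by
        intro w
        induction w using AddMonoidAlgebra.induction_linear with
        | zero => simp
        | add x y hx hy => rw [map_add]; exact add_mem hx hy
        | single x s =>
          have : AddMonoidAlgebra.single x s = s • AddMonoidAlgebra.single x (1 : 𝕜) := by simp
          rw [this, map_smul, AddMonoidAlgebra.push_single]
          exact Submodule.smul_mem _ _ (single_mem_nonGenerating
            (tuples_span_ne_top hM.1 fun i => hπM (x i)))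
      -- The projection π moves points within cosets of T only, so averaging over T kills the
      -- difference. It fixes the other minimal submodules pointwise, so vanishing there survives.
      refine ⟨c' - push 𝕜 (π.tupleMap r) c', fun T' hT' h => ?_, ?_⟩
      · rw [mul_sub, sub_eq_zero]
        rcases eq_or_ne T' T with rfl | hne
        · have : LinearMap.mulLeft 𝕜 (avg 𝕜 (T'.tuples r)) =
              LinearMap.mulLeft 𝕜 (avg 𝕜 (T'.tuples r)) ∘ₗ (push 𝕜 (π.tupleMap r)).toLinearMap := by
            refine AddMonoidAlgebra.linearMap_ext fun x => ?_
            simp only [LinearMap.comp_apply, AlgHom.toLinearMap_apply,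
              AddMonoidAlgebra.push_single, LinearMap.mulLeft_apply]
            exact AddMonoidAlgebra.avg_mul_single_eq fun i => hπT (x i)
          exact LinearMap.congr_fun this c'
        · have h0 : avg 𝕜 (T'.tuples r) * c' = 0 := by
            refine hc' T' hT' (h.imp_left fun h => ?_)
            exact (Finset.mem_insert.1 h).resolve_left hne
          have hT'M : ∀ t ∈ T', π t = t := fun t ht => hπid t (hother T' hT' hne ht)
          have hfix : ∀ t ∈ T'.tuples r, π.tupleMap r t = t := fun t ht =>
            funext fun i => hT'M _ (ht i)
          have h1 : push 𝕜 (π.tupleMap r) (avg 𝕜 (T'.tuples r)) = avg 𝕜 (T'.tuples r) :=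
            AddMonoidAlgebra.push_avg_eq (isUnit_natCard_tuples hAu T')
              (fun t ht => (hfix t ht).symm ▸ ht) fun t ht => ⟨t, ht, hfix t ht⟩
          rw [h0, ← h1, ← map_mul, h0, map_zero]
      · rw [sub_right_comm]
        exact sub_mem hcc' (hpush c')
  have : Finite (Submodule R A) := Finite.of_injective _ SetLike.coe_injective
  obtain ⟨c', h, h'⟩ := key (Set.toFinite (Set.univ : Set (Submodule R A))).toFinset
  exact ⟨c', fun T hT => h T hT (by simp), h'⟩

/-- Combining interpolations on the single orbits of generating tuples. -/
theorem exists_rankSpan_of_orbits [Finite A] (ω : AddMonoidAlgebra 𝕜 (Fin k → A))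
    (h : ∀ x : Fin k → A, Submodule.span R (Set.range x) = ⊤ → ∃ κ ∈ rankSpan 𝕜 R r k,
      (∀ φ : A ≃ₗ[R] A, tupleAct 𝕜 R A k κ
          (AddMonoidAlgebra.single ((φ : A →ₗ[R] A).tupleMap k x) 1) -
        AddMonoidAlgebra.single ((φ : A →ₗ[R] A).tupleMap k x) 1 * ω ∈ nonGenerating 𝕜 R A k) ∧
      ∀ y, (¬ ∃ φ : A ≃ₗ[R] A, y = (φ : A →ₗ[R] A).tupleMap k x) →
        tupleAct 𝕜 R A k κ (AddMonoidAlgebra.single y 1) = 0) :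
    ∃ κ ∈ rankSpan 𝕜 R r k, (∀ y : Fin k → A, Submodule.span R (Set.range y) = ⊤ →
        tupleAct 𝕜 R A k κ (AddMonoidAlgebra.single y 1) - AddMonoidAlgebra.single y 1 * ω ∈
          nonGenerating 𝕜 R A k) ∧
      ∀ y : Fin k → A, Submodule.span R (Set.range y) ≠ ⊤ →
        tupleAct 𝕜 R A k κ (AddMonoidAlgebra.single y 1) = 0 := by
  classical
  have := Fintype.ofFinite A
  let s : Setoid (Fin k → A) :=
    { r := fun x y => ∃ φ : A ≃ₗ[R] A, y = (φ : A →ₗ[R] A).tupleMap k x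
      iseqv :=
        { refl := fun x => ⟨LinearEquiv.refl R A, rfl⟩
          symm := by
            rintro x _ ⟨φ, rfl⟩
            exact ⟨φ.symm, funext fun i => by simp⟩
          trans := by
            rintro x _ _ ⟨φ, rfl⟩ ⟨ψ, rfl⟩
            exact ⟨φ ≪≫ₗ ψ, funext fun i => by simp⟩ } }
  let rep : (Fin k → A) → (Fin k → A) := fun x => (Quotient.mk s x).out
  have hrep : ∀ x, ∃ φ : A ≃ₗ[R] A, x = (φ : A →ₗ[R] A).tupleMap k (rep x) := fun x =>
    Quotient.mk_out (s := s) x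
  choose! F hF hF1 hF2 using h
  -- One representative per orbit of generating tuples: each generating tuple is seen by exactly one
  -- summand.
  let I : Finset (Fin k → A) :=
    Finset.univ.filter fun x => Submodule.span R (Set.range x) = ⊤ ∧ rep x = x
  refine ⟨∑ x ∈ I, F x, sum_mem fun x hx => hF x (by simpa [I] using (Finset.mem_filter.1 hx).2.1),
    fun y hy => ?_, fun y hy => ?_⟩
  · obtain ⟨φ, hφ⟩ := hrep y
    have hgen : Submodule.span R (Set.range (rep y)) = ⊤ := by
      rwa [hφ, span_range_tupleMap_equiv] at hy
    have hmem : rep y ∈ I := by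
      refine Finset.mem_filter.2 ⟨Finset.mem_univ _, hgen, ?_⟩
      exact congrArg Quotient.out (Quotient.out_eq (Quotient.mk s y))
    rw [map_sum, LinearMap.sum_apply, Finset.sum_eq_single_of_mem _ hmem]
    · have := hF1 (rep y) hgen φ
      rwa [← hφ] at this
    · intro x hx hne
      obtain ⟨-, hxg, hxr⟩ := Finset.mem_filter.1 hx
      refine hF2 x hxg y fun hxy => hne ?_
      rw [← hxr]
      exact congrArg Quotient.out (Quotient.sound (s := s) hxy)
  · rw [map_sum, LinearMap.sum_apply]
    refine Finset.sum_eq_zero fun x hx => ?_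
    obtain ⟨-, hxg, -⟩ := Finset.mem_filter.1 hx
    refine hF2 x hxg y ?_
    rintro ⟨φ, rfl⟩
    exact hy ((span_range_tupleMap_equiv φ x).2 hxg)

theorem exists_matrix_tupleHom_eq {g : A} (hg : Submodule.span R {g} = ⊤) (x : Fin k → A) :
    ∃ v : Fin k → R, ∀ i, v i • g = x i := by
  choose v hv using fun i => Submodule.mem_span_singleton.1 (hg ▸ Submodule.mem_top : x i ∈ _)
  exact ⟨v, hv⟩

end NonGenerating

/-! ### The rank identities for semisimple and for arbitrary distributive modules -/

section RankIdentity

universe u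

variable {𝕜 R : Type*} [Ring R] [CommRing 𝕜] {k : ℕ}

theorem isUnit_natCard_submodule {A : Type*} [AddCommGroup A] [Module R A] [Finite A]
    (hA : IsUnit (Nat.card A : 𝕜)) (X : Submodule R A) : IsUnit (Nat.card X : 𝕜) :=
  AddMonoidAlgebra.isUnit_natCard_subgroup hA X.toAddSubgroup

theorem natCard_submodule_lt {A : Type*} [AddCommGroup A] [Module R A] [Finite A]
    {X : Submodule R A} (hX : X ≠ ⊤) : Nat.card X < Nat.card A := by
  refine lt_of_le_of_ne (Nat.card_le_card_of_injective _ X.injective_subtype) fun h => hX ?_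
  have := X.injective_subtype.bijective_of_nat_card_le h.ge
  simpa using LinearMap.range_eq_top.2 this.2

theorem rankIdentity_of_modulo_nonGenerating {A : Type*} [AddCommGroup A] [Module R A] {r : ℕ}
    {κ₁ κ₂ : MonoidAlgebra 𝕜 (Matrix (Fin k) (Fin k) R)} (h₁ : κ₁ ∈ rankSpan 𝕜 R r k)
    (h₂ : κ₂ ∈ rankSpan 𝕜 R r k)
    (h₁' : ∀ w ∈ nonGenerating 𝕜 R A k, tupleAct 𝕜 R A k (1 - κ₁) w = 0)
    (h₂' : ∀ w, tupleAct 𝕜 R A k (1 - κ₂) w ∈ nonGenerating 𝕜 R A k) :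
    RankIdentity 𝕜 R A r k := by
  obtain ⟨κ, hκ, he⟩ := exists_one_sub_mul_one_sub h₁ h₂
  refine ⟨κ, hκ, LinearMap.ext fun w => ?_⟩
  rw [he, map_mul, Module.End.mul_apply, h₁' _ (h₂' w), LinearMap.zero_apply]

/-- On tuples of elements of a finite semisimple distributive module, a combination of matrices of
rank one acts as the identity. -/
theorem IsDistributiveModule.rankIdentity_one [Finite R] (hR : IsUnit (Nat.card R : 𝕜)) {A : Type u}
    [AddCommGroup A] [Module R A] [Finite A] [hs : IsSemisimpleModule R A]
    (hA : IsDistributiveModule R A) (hAu : IsUnit (Nat.card A : 𝕜)) : RankIdentity 𝕜 R A 1 k := by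
  induction hN : Nat.card A using Nat.strong_induction_on generalizing A with
  | _ N ih =>
    subst hN
    obtain ⟨κ₁, h₁, h₁'⟩ := exists_rankSpan_vanishing_on_nonGenerating
      (𝕜 := 𝕜) (R := R) (A := A) (k := k) (r := 1) fun X hX =>
        ih (Nat.card X) (natCard_submodule_lt hX) (hA.of_injective X.injective_subtype)
          (isUnit_natCard_submodule hAu X) rfl
    obtain ⟨g, hg⟩ := hA.exists_span_singleton_eq_top
    obtain ⟨c, hc, hcg⟩ := hA.exists_avg_mul_eq_zero hAu
      (c := AddMonoidAlgebra.single (fun _ : Fin 1 => g) (1 : 𝕜)) fun T hT hle => by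
        obtain ⟨M, hM⟩ := exists_isCompl T
        have hMc : IsCoatom M := hM.isAtom_iff_isCoatom.1 hT
        -- A complement of a minimal submodule is maximal here, so no minimal submodule lies in the
        -- radical.
        exact absurd (hle M hMc) ((hT.not_le_iff_disjoint).2 hM.disjoint)
    obtain ⟨κ₂, h₂, h₂', h₂''⟩ := exists_rankSpan_of_orbits (𝕜 := 𝕜) (R := R) (A := A) (r := 1)
      (1 : AddMonoidAlgebra 𝕜 (Fin k → A)) fun x hx => by
        obtain ⟨v, hv⟩ := exists_matrix_tupleHom_eq hg x
        obtain ⟨κ, hκ, hκ1, hκ2⟩ := exists_rankSpan_interpolation hR hAu hx hc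
          (Matrix.of fun i (_ : Fin 1) => v i)
        refine ⟨κ, hκ, fun φ => ?_, hκ2⟩
        have hvx : (Matrix.of fun i (_ : Fin 1) => v i).tupleHom A (fun _ => g) = x :=
          funext fun i => by simp [Matrix.tupleHom_apply, hv]
        have hsing : AddMonoidAlgebra.single ((φ : A →ₗ[R] A).tupleMap k x) (1 : 𝕜) =
            push 𝕜 ((Matrix.of fun i (_ : Fin 1) => v i).tupleHom A)
              (push 𝕜 ((φ : A →ₗ[R] A).tupleMap 1) (AddMonoidAlgebra.single (fun _ => g) 1)) := by
          rw [AddMonoidAlgebra.push_single, AddMonoidAlgebra.push_single,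
            Matrix.tupleHom_tupleMap, hvx]
        rw [hκ1, mul_one, hsing, ← map_sub, ← map_sub]
        exact push_tupleHom_mem_nonGenerating _ (push_tupleMap_mem_nonGenerating φ hcg)
    refine rankIdentity_of_modulo_nonGenerating h₁ h₂ h₁' fun w => ?_
    suffices h : (⊤ : Submodule 𝕜 _) ≤ (nonGenerating 𝕜 R A k).comap
      (tupleAct 𝕜 R A k (1 - κ₂)) from h (Submodule.mem_top (x := w))
    rw [← AddMonoidAlgebra.span_range_single]
    refine Submodule.span_le.2 ?_
    rintro _ ⟨y, rfl⟩
    simp only [Submodule.comap_coe, Set.mem_preimage, map_sub, map_one, LinearMap.sub_apply,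
      Module.End.one_apply, SetLike.mem_coe]
    by_cases hy : Submodule.span R (Set.range y) = ⊤
    · rw [← neg_sub, ← mul_one (AddMonoidAlgebra.single y (1 : 𝕜))]
      exact neg_mem (by simpa using h₂' y hy)
    · rw [h₂'' y hy, sub_zero]
      exact single_mem_nonGenerating hy

/-- The minimal submodules contained in the radical. -/
def radicalAtoms (R A : Type*) [Ring R] [AddCommGroup A] [Module R A] : Set (Submodule R A) :=
  {T | IsAtom T ∧ ∀ M : Submodule R A, IsCoatom M → T ≤ M}

section Omega

variable {A : Type*} [AddCommGroup A] [Module R A] [Finite A]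

theorem finite_radicalAtoms : (radicalAtoms R A).Finite := by
  have : Finite (Submodule R A) := Finite.of_injective _ SetLike.coe_injective
  exact Set.toFinite _

variable (𝕜 R A) in
/-- The projection away from the averages over minimal submodules in the radical. -/
noncomputable def radicalProjection (k : ℕ) : AddMonoidAlgebra 𝕜 (Fin k → A) :=
  ∏ T ∈ (finite_radicalAtoms (R := R) (A := A)).toFinset, (1 - avg 𝕜 (T.tuples k))

/-- By distributivity an automorphism maps every minimal submodule onto itself, so it preserves each
factor. -/
theorem push_tupleMap_radicalProjection (hA : IsDistributiveModule R A)
    (hAu : IsUnit (Nat.card A : 𝕜)) (φ : A ≃ₗ[R] A) :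
    push 𝕜 ((φ : A →ₗ[R] A).tupleMap k) (radicalProjection 𝕜 R A k) =
      radicalProjection 𝕜 R A k := by
  rw [radicalProjection, map_prod]
  refine Finset.prod_congr rfl fun T hT => ?_
  have hT' : T ∈ radicalAtoms R A := by simpa using hT
  have hmap := hA.map_eq_of_isAtom hT'.1 φ
  have hmem : ∀ t ∈ T, φ t ∈ T := fun t ht => hmap ▸ ⟨t, ht, rfl⟩
  have hmem' : ∀ t ∈ T, ∃ s ∈ T, φ s = t := fun t ht => by
    rw [← hmap] at ht
    exact ht
  rw [map_sub, map_one, AddMonoidAlgebra.push_avg_eq (isUnit_natCard_tuples hAu T)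
    (fun t ht i => hmem _ (ht i))]
  intro t ht
  choose s hs hst using fun i => hmem' _ (ht i)
  exact ⟨s, hs, funext hst⟩

theorem radicalProjection_mul {w : AddMonoidAlgebra 𝕜 (Fin k → A)}
    (hw : ∀ T : Submodule R A, IsAtom T → avg 𝕜 (T.tuples k) * w = 0) :
    radicalProjection 𝕜 R A k * w = w := by
  have key : ∀ I : Finset (Submodule R A), (∀ T ∈ I, IsAtom T) →
      (∏ T ∈ I, (1 - avg 𝕜 (T.tuples k))) * w = w := by
    classical
    intro I
    induction I using Finset.induction_on with
    | empty => simp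
    | insert T I hT ih =>
      intro h
      rw [Finset.prod_insert hT, mul_assoc, ih fun T' hT' => h T' (Finset.mem_insert_of_mem hT'),
        sub_mul, one_mul, hw T (h T (Finset.mem_insert_self _ _)), sub_zero]
  exact key _ fun T hT => ((finite_radicalAtoms.mem_toFinset).1 hT).1

/-- The matrix maps T^k into T^r, so the average over T^r absorbs the image of the average over T^k
and kills the factor belonging to T. -/
theorem avg_mul_push_radicalProjection {r : ℕ} (hAu : IsUnit (Nat.card A : 𝕜))
    (L : Matrix (Fin r) (Fin k) R) {T : Submodule R A} (hT : T ∈ radicalAtoms R A) :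
    avg 𝕜 (T.tuples r) * push 𝕜 (L.tupleHom A) (radicalProjection 𝕜 R A k) = 0 := by
  rw [radicalProjection, map_prod,
    ← Finset.mul_prod_erase _ _ ((finite_radicalAtoms.mem_toFinset).2 hT), ← mul_assoc, map_sub,
    map_one, mul_sub, mul_one, AddMonoidAlgebra.avg_mul_push_avg (isUnit_natCard_tuples hAu T)
      (fun t ht => Submodule.tupleHom_mem_tuples L ht), sub_self, zero_mul]

theorem exists_push_eq_radicalProjection :
    ∃ w, push 𝕜 ((sSup (radicalAtoms R A)).subtype.tupleMap k) w = radicalProjection 𝕜 R A k := by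
  rw [← AlgHom.mem_range, radicalProjection]
  refine Subalgebra.prod_mem _ fun T hT => ?_
  refine sub_mem (one_mem _) (Subalgebra.smul_mem _ (sum_mem fun t ht => ?_) _)
  have hle : T ≤ sSup (radicalAtoms R A) := le_sSup ((finite_radicalAtoms.mem_toFinset).1 hT)
  have ht' : t ∈ T.tuples k := by simpa using ht
  refine (AlgHom.mem_range _).2
    ⟨AddMonoidAlgebra.single (fun i => ⟨t i, hle (Submodule.mem_tuples.1 ht' i)⟩) 1, ?_⟩
  rw [AddMonoidAlgebra.push_single]
  rfl

/-- The projection is supported on tuples from the radical, and adding these to a tuple in a maximal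
submodule does not leave it. -/
theorem radicalProjection_mul_single_mem_nonGenerating {y : Fin k → A}
    (hy : Submodule.span R (Set.range y) ≠ ⊤) :
    radicalProjection 𝕜 R A k * AddMonoidAlgebra.single y 1 ∈ nonGenerating 𝕜 R A k := by
  obtain ⟨w, hw⟩ := exists_push_eq_radicalProjection (𝕜 := 𝕜) (R := R) (A := A) (k := k)
  have : Finite (Submodule R A) := Finite.of_injective _ SetLike.coe_injective
  obtain ⟨M, hM, hyM⟩ := (eq_top_or_exists_le_coatom (Submodule.span R (Set.range y))).resolve_left hy
  have hle : sSup (radicalAtoms R A) ≤ M := sSup_le fun T hT => hT.2 M hM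
  rw [← hw]
  clear hw
  induction w using AddMonoidAlgebra.induction_linear with
  | zero => simp
  | add x y hx hy => rw [map_add, add_mul]; exact add_mem hx hy
  | single x s =>
    rw [AddMonoidAlgebra.push_single, AddMonoidAlgebra.single_mul_single, mul_one]
    have : ∀ z : Fin k → A, AddMonoidAlgebra.single z s = s • AddMonoidAlgebra.single z (1 : 𝕜) :=
      fun z => by simp
    rw [this]
    refine Submodule.smul_mem _ _ (single_mem_nonGenerating (tuples_span_ne_top hM.1 fun i => ?_))
    exact M.add_mem (hle (x i).2) (hyM (Submodule.subset_span ⟨i, rfl⟩))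

theorem isSemisimpleModule_sSup_radicalAtoms {A : Type*} [AddCommGroup A] [Module R A] :
    IsSemisimpleModule R (sSup (radicalAtoms R A) : Submodule R A) := by
  rw [sSup_eq_iSup]
  refine isSemisimpleModule_biSup_of_isSemisimpleModule_submodule fun T hT => ?_
  have : IsSimpleModule R T := isSimpleModule_iff_isAtom.2 hT.1
  infer_instance

/-- Interpolation on one orbit, twisted by a matrix of rank one. -/
theorem IsDistributiveModule.exists_rankSpan_two_interpolation [Finite R] (hR : IsUnit (Nat.card R : 𝕜))
    (hA : IsDistributiveModule R A) (hAu : IsUnit (Nat.card A : 𝕜)) {x : Fin k → A}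
    (hx : Submodule.span R (Set.range x) = ⊤) {μ : MonoidAlgebra 𝕜 (Matrix (Fin k) (Fin k) R)}
    (hμ : μ ∈ rankSpan 𝕜 R 1 k) :
    ∃ κ ∈ rankSpan 𝕜 R 2 k,
      (∀ φ : A ≃ₗ[R] A, tupleAct 𝕜 R A k κ
          (AddMonoidAlgebra.single ((φ : A →ₗ[R] A).tupleMap k x) 1) -
        AddMonoidAlgebra.single ((φ : A →ₗ[R] A).tupleMap k x) 1 *
          tupleAct 𝕜 R A k μ (radicalProjection 𝕜 R A k) ∈ nonGenerating 𝕜 R A k) ∧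
      ∀ y, (¬ ∃ φ : A ≃ₗ[R] A, y = (φ : A →ₗ[R] A).tupleMap k x) →
        tupleAct 𝕜 R A k κ (AddMonoidAlgebra.single y 1) = 0 := by
  obtain ⟨g, hg⟩ := hA.exists_span_singleton_eq_top
  obtain ⟨v₁, hv₁⟩ := exists_matrix_tupleHom_eq hg x
  induction hμ using Submodule.span_induction with
  | zero => exact ⟨0, zero_mem _, by simp, by simp⟩
  | add μ ν _ _ ihμ ihν =>
    obtain ⟨κ, hκ, h1, h2⟩ := ihμ
    obtain ⟨κ', hκ', h1', h2'⟩ := ihν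
    refine ⟨κ + κ', add_mem hκ hκ', fun φ => ?_, fun y hy => ?_⟩
    · rw [map_add, map_add, LinearMap.add_apply, LinearMap.add_apply, mul_add, add_sub_add_comm]
      exact add_mem (h1 φ) (h1' φ)
    · rw [map_add, LinearMap.add_apply, h2 y hy, h2' y hy, add_zero]
  | smul s μ _ ihμ =>
    obtain ⟨κ, hκ, h1, h2⟩ := ihμ
    refine ⟨s • κ, Submodule.smul_mem _ _ hκ, fun φ => ?_, fun y hy => ?_⟩
    · rw [map_smul, map_smul, LinearMap.smul_apply, LinearMap.smul_apply, mul_smul_comm,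
        ← smul_sub]
      exact Submodule.smul_mem _ _ (h1 φ)
    · rw [map_smul, LinearMap.smul_apply, h2 y hy, smul_zero]
  | mem μ hμ =>
    obtain ⟨v₂, l, rfl⟩ := hμ
    -- The first column of v turns g into x, the second carries the rank one matrix; L feeds only
    -- the second.
    let L : Matrix (Fin 2) (Fin k) R := Matrix.of ![0, l 0]
    let v : Matrix (Fin k) (Fin 2) R := Matrix.of fun i => ![v₁ i, v₂ i 0]
    have hvL : v * L = v₂ * l := by
      ext i j
      simp [v, L, Matrix.mul_apply, Fin.sum_univ_two]
    have hvg : v.tupleHom A ![g, 0] = x := by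
      ext i
      simp [v, Matrix.tupleHom_apply, hv₁]
    obtain ⟨c, hc, hcc⟩ := hA.exists_avg_mul_eq_zero hAu
      (c := AddMonoidAlgebra.single ![g, 0] (1 : 𝕜) *
        push 𝕜 (L.tupleHom A) (radicalProjection 𝕜 R A k)) fun T hT hle => by
        rw [mul_left_comm, avg_mul_push_radicalProjection hAu L ⟨hT, hle⟩, mul_zero]
    obtain ⟨κ, hκ, h1, h2⟩ := exists_rankSpan_interpolation hR hAu hx hc v
    refine ⟨κ, hκ, fun φ => ?_, h2⟩
    have hpush : AddMonoidAlgebra.single ((φ : A →ₗ[R] A).tupleMap k x) 1 *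
        tupleAct 𝕜 R A k (MonoidAlgebra.single (v₂ * l) 1) (radicalProjection 𝕜 R A k) =
        push 𝕜 (v.tupleHom A) (push 𝕜 ((φ : A →ₗ[R] A).tupleMap 2)
          (AddMonoidAlgebra.single ![g, 0] (1 : 𝕜) *
            push 𝕜 (L.tupleHom A) (radicalProjection 𝕜 R A k))) := by
      rw [map_mul, map_mul, AddMonoidAlgebra.push_single, AddMonoidAlgebra.push_single,
        Matrix.tupleHom_tupleMap, hvg]
      congr 1
      rw [tupleAct_single, one_smul, ← hvL]
      conv_lhs => rw [← push_tupleMap_radicalProjection hA hAu φ]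
      simp only [AddMonoidAlgebra.push_push]
      congr 2
      refine AddMonoidHom.ext fun z => ?_
      simp only [AddMonoidHom.comp_apply, Matrix.tupleHom_mul, Matrix.tupleHom_tupleMap]
    rw [h1, hpush, ← map_sub, ← map_sub]
    exact push_tupleHom_mem_nonGenerating _ (push_tupleMap_mem_nonGenerating φ hcc)

end Omega

/-- On tuples of elements of a finite distributive module, a combination of matrices of rank two
acts as the identity. -/
theorem IsDistributiveModule.rankIdentity_two [Finite R] (hR : IsUnit (Nat.card R : 𝕜)) {A : Type u}
    [AddCommGroup A] [Module R A] [Finite A]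
    (hA : IsDistributiveModule R A) (hAu : IsUnit (Nat.card A : 𝕜)) : RankIdentity 𝕜 R A 2 k := by
  induction hN : Nat.card A using Nat.strong_induction_on generalizing A with
  | _ N ih =>
    subst hN
    obtain ⟨κ₁, h₁, h₁'⟩ := exists_rankSpan_vanishing_on_nonGenerating
      (𝕜 := 𝕜) (R := R) (A := A) (k := k) (r := 2) fun X hX =>
        ih (Nat.card X) (natCard_submodule_lt hX) (hA.of_injective X.injective_subtype)
          (isUnit_natCard_submodule hAu X) rfl
    obtain ⟨κ₃, h₃, h₃'⟩ := exists_rankSpan_vanishing_mod_atoms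
      (𝕜 := 𝕜) (R := R) (A := A) (k := k) (r := 2) fun T hT => by
        have : Finite (A ⧸ T) := Finite.of_surjective _ T.mkQ_surjective
        have hcard := T.card_eq_card_quotient_mul_card
        refine ih (Nat.card (A ⧸ T)) ?_ (hA.of_surjective T.mkQ_surjective) ?_ rfl
        · have hT1 : 1 < Nat.card T := by
            have := (Submodule.nontrivial_iff_ne_bot).2 hT.1
            exact Finite.one_lt_card
          have hpos : 0 < Nat.card (A ⧸ T) := Nat.card_pos
          nlinarith
        · refine isUnit_of_dvd_unit (Nat.cast_dvd_cast ?_) hAu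
          exact Dvd.intro_left _ hcard.symm
    have hsoc := isSemisimpleModule_sSup_radicalAtoms (R := R) (A := A)
    obtain ⟨μ, hμ, hμ'⟩ := (hA.of_injective
      (sSup (radicalAtoms R A)).injective_subtype).rankIdentity_one (𝕜 := 𝕜) (k := k) hR
        (isUnit_natCard_submodule hAu _)
    -- The radical projection comes from the semisimple submodule on which μ acts as the identity.
    have hμω : tupleAct 𝕜 R A k μ (radicalProjection 𝕜 R A k) = radicalProjection 𝕜 R A k := by
      obtain ⟨w, hw⟩ := exists_push_eq_radicalProjection (𝕜 := 𝕜) (R := R) (A := A) (k := k)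
      rw [← hw, ← push_tupleMap_tupleAct]
      congr 1
      have := LinearMap.congr_fun hμ' w
      rw [map_sub, map_one, LinearMap.sub_apply, LinearMap.zero_apply, sub_eq_zero] at this
      exact this.symm
    obtain ⟨κ₂, h₂, h₂', h₂''⟩ := exists_rankSpan_of_orbits (𝕜 := 𝕜) (R := R) (A := A) (r := 2)
      (radicalProjection 𝕜 R A k) fun x hx => by
        simpa only [hμω] using hA.exists_rankSpan_two_interpolation hR hAu hx hμ
    have hκ₂ : ∀ w, radicalProjection 𝕜 R A k * w - tupleAct 𝕜 R A k κ₂ w ∈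
        nonGenerating 𝕜 R A k := by
      intro w
      suffices h : (⊤ : Submodule 𝕜 _) ≤ (nonGenerating 𝕜 R A k).comap
        (LinearMap.mulLeft 𝕜 (radicalProjection 𝕜 R A k) - tupleAct 𝕜 R A k κ₂) from
          h (Submodule.mem_top (x := w))
      rw [← AddMonoidAlgebra.span_range_single]
      refine Submodule.span_le.2 ?_
      rintro _ ⟨y, rfl⟩
      simp only [Submodule.comap_coe, Set.mem_preimage, LinearMap.sub_apply,
        LinearMap.mulLeft_apply, SetLike.mem_coe]
      by_cases hy : Submodule.span R (Set.range y) = ⊤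
      · rw [← neg_sub, mul_comm]
        exact neg_mem (h₂' y hy)
      · rw [h₂'' y hy, sub_zero]
        exact radicalProjection_mul_single_mem_nonGenerating hy
    -- The image of 1 - κ₃ is fixed by the radical projection, which κ₂ imitates modulo
    -- non-generating tuples.
    obtain ⟨κ, hκ, he⟩ := exists_one_sub_mul_one_sub h₂ h₃
    refine rankIdentity_of_modulo_nonGenerating h₁ hκ h₁' fun w => ?_
    rw [he, map_mul, Module.End.mul_apply, map_sub, map_one, LinearMap.sub_apply,
      Module.End.one_apply]
    have := hκ₂ (tupleAct 𝕜 R A k (1 - κ₃) w)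
    rwa [radicalProjection_mul (h₃' w)] at this

end RankIdentity

/-! ### From group algebras to functions with values in an S-module -/

section Descent

variable {𝕜 R A : Type*} [Ring R] [AddCommGroup A] [Module R A] [CommRing 𝕜] {k r n : ℕ}

theorem rankSpan_mono (h : r ≤ n) : rankSpan 𝕜 R r k ≤ rankSpan 𝕜 R n k := by
  refine Submodule.span_le.2 ?_
  rintro _ ⟨v, w, rfl⟩
  let E : Matrix (Fin r) (Fin n) R := Matrix.of fun i j => if Fin.castLE h i = j then 1 else 0
  have hE : E * E.transpose = 1 := by
    ext i j
    simp [E, Matrix.mul_apply, Matrix.one_apply, Fin.castLE_inj, eq_comm]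
  have : v * w = (v * E) * (E.transpose * w) := by
    rw [Matrix.mul_assoc v, ← Matrix.mul_assoc E, hE, Matrix.one_mul]
  rw [this]
  exact Submodule.subset_span ⟨_, _, rfl⟩

theorem RankIdentity.mono (h : r ≤ n) (hA : RankIdentity 𝕜 R A r k) : RankIdentity 𝕜 R A n k := by
  obtain ⟨κ, hκ, h0⟩ := hA
  exact ⟨κ, rankSpan_mono h hκ, h0⟩

theorem IsDistributiveModule.of_bijective {R' : Type*} [Ring R'] {σ : R →+* R'}
    [RingHomSurjective σ] {A' : Type*} [AddCommGroup A'] [Module R' A'] {f : A →ₛₗ[σ] A'}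
    (hf : Function.Bijective f) (hA : IsDistributiveModule R A) : IsDistributiveModule R' A' := by
  intro X Y Z
  apply (Submodule.orderIsoMapComapOfBijective f hf).symm.injective
  simp only [map_inf, map_sup]
  exact hA _ _ _

/-- The ring of endomorphisms of the underlying group of a module that are induced by scalars. -/
abbrev scalarRing (R A : Type*) [Ring R] [AddCommGroup A] [Module R A] : Subring (AddMonoid.End A) :=
  (Module.toAddMonoidEnd R A).range

/-- The identity map from a module to the same module over its ring of scalar endomorphisms. -/
def toScalarRingModule (R A : Type*) [Ring R] [AddCommGroup A] [Module R A] :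
    A →ₛₗ[(Module.toAddMonoidEnd R A).rangeRestrict] A where
  toFun := id
  map_add' _ _ := rfl
  map_smul' _ _ := rfl

/-- Interpolation needs a finite ring of invertible order. The image of R in End(A) is one, as its
order divides a power of |A|, and A has the same submodules over it. -/
theorem rankIdentity_scalarRing [Finite A] (hA : IsDistributiveModule R A)
    (hAu : IsUnit (Nat.card A : 𝕜)) (hr : 2 ≤ r ∨ 1 ≤ r ∧ IsSemisimpleModule R A) :
    RankIdentity 𝕜 (scalarRing R A) A r k := by
  have : RingHomSurjective (Module.toAddMonoidEnd R A).rangeRestrict :=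
    ⟨RingHom.rangeRestrict_surjective _⟩
  have : Finite (AddMonoid.End A) := DFunLike.finite _
  let ι : scalarRing R A →+ (A → A) :=
    { toFun := fun f => f.1, map_zero' := rfl, map_add' := fun _ _ => rfl }
  have hι : Function.Injective ι := fun f g h => Subtype.ext (DFunLike.coe_injective h)
  have hR : IsUnit (Nat.card (scalarRing R A) : 𝕜) := by
    refine isUnit_of_dvd_unit (Nat.cast_dvd_cast (AddSubgroup.card_dvd_of_injective ι hι)) ?_
    rw [Nat.card_fun, Nat.cast_pow]
    exact hAu.pow _
  have hA' : IsDistributiveModule (scalarRing R A) A :=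
    hA.of_bijective (f := toScalarRingModule R A) Function.bijective_id
  rcases hr with hr | ⟨hr, hs⟩
  · exact (hA'.rankIdentity_two hR hAu).mono hr
  · have hs' : IsSemisimpleModule (scalarRing R A) A :=
      ((toScalarRingModule R A).isSemisimpleModule_iff_of_bijective Function.bijective_id).1 hs
    exact (hA'.rankIdentity_one hR hAu).mono hr

/-- Every function on tuples is one and the same affine combination of substitutions of matrices
of rank at most `r` in it. -/
theorem IsDistributiveModule.exists_sum_smul_comp [Finite A] (hA : IsDistributiveModule R A)
    {S B : Type*} [Ring S] [AddCommGroup B] [Module S B] (hAS : IsUnit (Nat.card A : S))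
    (hr : 2 ≤ r ∨ 1 ≤ r ∧ IsSemisimpleModule R A) :
    ∃ (N : ℕ) (s : Fin (N + 1) → S) (v : Fin (N + 1) → Matrix (Fin k) (Fin r) R)
      (h : Fin (N + 1) → Matrix (Fin r) (Fin k) R), ∑ i, s i = 1 ∧
      ∀ (f : (Fin k → A) → B) (x : Fin k → A),
        f x = ∑ i, s i • f ((v i).tupleHom A ((h i).tupleHom A x)) := by
  -- Coefficients must commute, so they are taken from the centre of S, where |A| stays invertible.
  have hu : IsUnit (Nat.card A : Subring.center S) := by
    obtain ⟨u, hu⟩ := hAS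
    have hmem : ((u⁻¹ : Sˣ) : S) ∈ Subring.center S := by
      rw [Subring.mem_center_iff]
      intro g
      have hc : Commute (u : S) g := by rw [hu]; exact Nat.cast_commute _ _
      exact hc.units_inv_left.symm
    refine IsUnit.of_mul_eq_one ⟨_, hmem⟩ (Subtype.ext ?_)
    simp [← hu]
  obtain ⟨κ, hκ, h0⟩ := rankIdentity_scalarRing (k := k) hA hu hr
  rw [map_sub, map_one, sub_eq_zero] at h0
  obtain ⟨N, s, g, hg⟩ := Submodule.mem_span_set'.1 hκ
  choose v h hvh using fun i => (g i).2
  choose lift hlift using RingHom.rangeRestrict_surjective (Module.toAddMonoidEnd R A)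
  have hmat : ∀ {m n : ℕ} (M : Matrix (Fin m) (Fin n) (scalarRing R A)) (x : Fin n → A),
      (M.map lift).tupleHom A x = M.tupleHom A x := by
    intro m n M x
    ext i
    rw [Matrix.tupleHom_apply, Matrix.tupleHom_apply]
    refine Finset.sum_congr rfl fun j _ => ?_
    exact congrArg (fun a : scalarRing R A => a • x j) (hlift (M i j))
  -- The factor S carries the constant function 1, whose expansion yields Σ s_i = 1 even if B is not
  -- faithful.
  have key : ∀ (f : (Fin k → A) → B × S) (x : Fin k → A),
      f x = ∑ i, (s i : S) • f ((v i).tupleHom A ((h i).tupleHom A x)) := by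
    intro f x
    let L : AddMonoidAlgebra (Subring.center S) (Fin k → A) →ₗ[Subring.center S] B × S :=
      Finsupp.linearCombination _ f ∘ₗ
        (AddMonoidAlgebra.coeffLinearEquiv (Subring.center S)).toLinearMap
    have hL : ∀ y, L (AddMonoidAlgebra.single y 1) = f y := fun y => by simp [L]
    have h1 := congrArg L (LinearMap.congr_fun h0 (AddMonoidAlgebra.single x 1))
    rw [Module.End.one_apply, hL, ← hg, map_sum, LinearMap.sum_apply, map_sum] at h1
    rw [h1]
    refine Finset.sum_congr rfl fun i _ => ?_
    rw [map_smul, LinearMap.smul_apply, map_smul, hvh, tupleAct_single, one_smul,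
      AddMonoidAlgebra.push_single, hL, Matrix.tupleHom_mul]
    rfl
  -- A zero summand ensures that the combination has positive arity.
  refine ⟨N, Fin.cons 0 fun i => s i, Fin.cons 0 fun i => (v i).map lift,
    Fin.cons 0 fun i => (h i).map lift, ?_, fun f x => ?_⟩
  · have := congrArg Prod.snd (key (fun _ => (0, 1)) 0)
    simpa [Fin.sum_univ_succ, Prod.snd_sum] using this.symm
  · rw [Fin.sum_univ_succ]
    simp only [Fin.cons_zero, Fin.cons_succ, zero_smul, zero_add, hmat]
    simpa [Prod.fst_sum] using congrArg Prod.fst (key (fun y => (f y, 0)) x)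

end Descent

/-! ### Generation and finiteness of clonoids -/

namespace FinitaryAlgebra

variable {R S A B : Type*} {𝔸 : FinitaryAlgebra A} {𝔹 : FinitaryAlgebra B}

theorem IsClonoid.clonoidGenerated_aryPart {C : FunctionClass A B} (hC : IsClonoid 𝔸 𝔹 C)
    {p : ℕ+} (h : ∀ G, IsClonoid 𝔸 𝔹 G → C.aryPart p ≤ G → C ≤ G) :
    clonoidGenerated 𝔸 𝔹 (C.aryPart p) = C :=
  le_antisymm (sInf_le ⟨hC, fun _ _ hf => hf.2⟩) (le_sInf fun G hG => h G hG.1 hG.2)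

/-- A clonoid is determined by its p-ary part, a subset of a finite set. -/
theorem finite_setOf_isClonoid [Finite A] [Finite B] (p : ℕ+)
    (h : ∀ C : FunctionClass A B, IsClonoid 𝔸 𝔹 C → clonoidGenerated 𝔸 𝔹 (C.aryPart p) = C) :
    {C : FunctionClass A B | IsClonoid 𝔸 𝔹 C}.Finite := by
  refine Set.Finite.of_finite_image (f := fun C => C p) (Set.toFinite _) fun C hC D hD hCD => ?_
  replace hCD : C p = D p := hCD
  have : C.aryPart p = D.aryPart p := by
    funext k
    ext f
    constructor
    · rintro ⟨rfl, hf⟩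
      exact ⟨rfl, hCD ▸ hf⟩
    · rintro ⟨rfl, hf⟩
      exact ⟨rfl, hCD.symm ▸ hf⟩
  rw [← h C hC, ← h D hD, this]

variable [Ring S] [AddCommGroup B] [Module S B]

/-- A member of a clonoid lies in a given clonoid, if it is an affine combination of substitutions
in `m`-ary members of it, and the given clonoid contains the latter. -/
theorem IsClonoid.mem_of_sum (h𝔹 : 𝔹.PolynomiallyEquivalent (ofModule S B))
    {C G : FunctionClass A B} (hC : IsClonoid 𝔸 𝔹 C) (hG : IsClonoid 𝔸 𝔹 G) {p : ℕ+} {m : ℕ}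
    (hp : (p : ℕ) = m) (hCG : C.aryPart p ≤ G) {k : ℕ+} {f : (Fin k → A) → B} (hf : f ∈ C k)
    {N : ℕ} {s : Fin (N + 1) → S} (hs : ∑ i, s i = 1)
    {u : Fin (N + 1) → Fin k → (Fin m → A) → A} (hu : ∀ i j, 𝔸.IsTermFunction (u i j))
    {t : Fin (N + 1) → Fin m → (Fin k → A) → A} (ht : ∀ i q, 𝔸.IsTermFunction (t i q))
    (hfs : ∀ x, f x = ∑ i, s i • f (fun j => u i j (fun q => t i q x))) : f ∈ G k := by
  subst hp
  have h1 : ∀ i, (fun y => f (fun j => u i j y)) ∈ G p := fun i =>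
    hCG p ⟨rfl, hC.1 p ⟨k, f, u i, hf, hu i, rfl⟩⟩
  have h2 : ∀ i, (fun x => f (fun j => u i j (fun q => t i q x))) ∈ G k := fun i =>
    hG.1 k ⟨p, _, t i, h1 i, ht i, rfl⟩
  exact hG.2 k ⟨⟨N + 1, N.succ_pos⟩, _, fun i x => f (fun j => u i j (fun q => t i q x)),
    h𝔹.isTermFunction_of_sum_eq_one N.succ_pos s hs, h2, funext hfs⟩

variable [Ring R] [AddCommGroup A] [Module R A]

theorem IsClonoid.generated_of_termEquivalent [Finite A] (hA : IsDistributiveModule R A)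
    (hAS : IsUnit (Nat.card A : S)) (h𝔹 : 𝔹.PolynomiallyEquivalent (ofModule S B)) {n : ℕ+}
    (hn : 2 ≤ (n : ℕ) ∨ 1 ≤ (n : ℕ) ∧ IsSemisimpleModule R A)
    (h𝔸 : 𝔸.TermEquivalent (ofModule R A)) {C : FunctionClass A B} (hC : IsClonoid 𝔸 𝔹 C) :
    clonoidGenerated 𝔸 𝔹 (C.aryPart n) = C := by
  refine hC.clonoidGenerated_aryPart fun G hG hCG k f hf => ?_
  obtain ⟨N, s, v, h, hs, hfs⟩ := hA.exists_sum_smul_comp (B := B) (k := k) hAS hn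
  have hlin : ∀ (m : ℕ+) (a : Fin m → R), 𝔸.IsTermFunction fun x : Fin m → A => ∑ i, a i • x i :=
    fun m a => (Set.ext_iff.1 (congrFun h𝔸 m) _).2 (isTermFunction_ofModule_linear a)
  exact hC.mem_of_sum h𝔹 hG rfl hCG hf hs (u := fun i j y => ∑ q, v i j q • y q)
    (fun i j => hlin n _) (t := fun i q x => ∑ j, h i q j • x j) (fun i q => hlin k _) (hfs f)

theorem IsClonoid.generated_of_polynomiallyEquivalent [Finite A] (hA : IsDistributiveModule R A)
    (hAS : IsUnit (Nat.card A : S)) (h𝔹 : 𝔹.PolynomiallyEquivalent (ofModule S B)) {n : ℕ+}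
    (hn : 2 ≤ (n : ℕ) ∨ 1 ≤ (n : ℕ) ∧ IsSemisimpleModule R A)
    (h𝔸 : 𝔸.PolynomiallyEquivalent (ofModule R A)) {C : FunctionClass A B}
    (hC : IsClonoid 𝔸 𝔹 C) : clonoidGenerated 𝔸 𝔹 (C.aryPart (n + 1)) = C := by
  refine hC.clonoidGenerated_aryPart fun G hG hCG k f hf => ?_
  obtain ⟨N, s, v, h, hs, hfs⟩ := hA.exists_sum_smul_comp (B := B) (k := k) hAS hn
  obtain ⟨j₀⟩ : Nonempty (Fin k) := ⟨⟨0, k.pos⟩⟩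
  have hp : ((n + 1 : ℕ+) : ℕ) = n + 1 := PNat.add_coe n 1
  -- The variable y 0 holds the base point x j₀. Relative to it all matrices act by idempotent
  -- combinations, which are term functions.
  refine hC.mem_of_sum h𝔹 hG hp hCG hf hs
    (u := fun i j y => y 0 + ∑ q, v i j q • (y (Fin.succ q) - y 0)) (fun i j => ?_)
    (t := fun i => Fin.cons (fun x => x j₀) fun q x => x j₀ + ∑ j, h i q j • (x j - x j₀))
    (fun i q => ?_) fun x => ?_
  · convert h𝔸.isTermFunction_of_sum_eq_one n.val.succ_pos
      (Fin.cons (1 - ∑ q, v i j q) (v i j)) (by simp [Fin.sum_univ_succ]) using 2 with y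
    simp only [Fin.sum_univ_succ, Fin.cons_zero, Fin.cons_succ, sub_smul, smul_sub, one_smul,
      Finset.sum_sub_distrib, Finset.sum_smul]
    abel
  · refine Fin.cases ?_ (fun q => ?_) q
    · exact .proj j₀
    · convert h𝔸.isTermFunction_of_sum_eq_one k.pos
        (h i q + Pi.single j₀ (1 - ∑ j, h i q j)) (by simp [Finset.sum_add_distrib]) using 2 with x
      simp only [Pi.add_apply, add_smul, Finset.sum_add_distrib, Pi.single_apply, ite_smul,
        zero_smul, Finset.sum_ite_eq', Finset.mem_univ, if_true, sub_smul, one_smul, smul_sub,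
        Finset.sum_sub_distrib, Finset.sum_smul, Fin.cons_succ]
      abel
  -- The expansion has the same coefficients for all functions, so it applies to a translate of f
  -- depending on x.
  · have := hfs (fun y => f fun j => x j₀ + y j) (fun j => x j - x j₀)
    simpa [Matrix.tupleHom_apply] using this

end FinitaryAlgebra

theorem isSemisimpleModule_of_jacobson_eq_bot {R A : Type*} [Ring R]
    [IsSemisimpleRing (R ⧸ Ring.jacobson R)] [AddCommGroup A] [Module R A]
    (h : Ring.jacobson R = ⊥) : IsSemisimpleModule R A := by
  have hinj : Function.Injective (Ideal.Quotient.mk (Ring.jacobson R)) := by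
    rw [RingHom.injective_iff_ker_eq_bot, Ideal.mk_ker, h]
  have : IsSemisimpleRing R :=
    (RingEquiv.ofBijective _ ⟨hinj, Ideal.Quotient.mk_surjective⟩).symm.isSemisimpleRing
  infer_instance

theorem mainTheorem1 {R S A B : Type*}
    [Ring R] [IsSemisimpleRing (R ⧸ Ring.jacobson R)]
    [AddCommGroup A] [Module R A] [Finite A] (hA : IsDistributiveModule R A)
    (n : ℕ+) (hn : Ring.jacobson R ^ (n : ℕ) = ⊥)
    [Ring S] [AddCommGroup B] [Module S B] (hAS : IsUnit (Nat.card A : S))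
    (𝔸 : FinitaryAlgebra A) (h𝔸 : 𝔸.PolynomiallyEquivalent (FinitaryAlgebra.ofModule R A))
    (𝔹 : FinitaryAlgebra B) (h𝔹 : 𝔹.PolynomiallyEquivalent (FinitaryAlgebra.ofModule S B)) :
    (∀ C : FunctionClass A B, FinitaryAlgebra.IsClonoid 𝔸 𝔹 C →
      FinitaryAlgebra.clonoidGenerated 𝔸 𝔹 (C.aryPart (n + 1)) = C) ∧
    (𝔸.TermEquivalent (FinitaryAlgebra.ofModule R A) →
      ∀ C : FunctionClass A B, FinitaryAlgebra.IsClonoid 𝔸 𝔹 C →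
        FinitaryAlgebra.clonoidGenerated 𝔸 𝔹 (C.aryPart n) = C) ∧
    (Finite B → {C : FunctionClass A B | FinitaryAlgebra.IsClonoid 𝔸 𝔹 C}.Finite) := by
  -- The exponent n matters only here: for n = 1 the radical vanishes and rank one suffices.
  have hrank : 2 ≤ (n : ℕ) ∨ 1 ≤ (n : ℕ) ∧ IsSemisimpleModule R A := by
    rcases (Nat.succ_le_of_lt n.pos).eq_or_lt with h1 | h2
    · refine Or.inr ⟨h1.le, isSemisimpleModule_of_jacobson_eq_bot ?_⟩
      rwa [← h1, Nat.succ_eq_add_one, zero_add, Submodule.pow_one] at hn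
    · exact Or.inl h2
  have hpoly := fun (C : FunctionClass A B) (hC : FinitaryAlgebra.IsClonoid 𝔸 𝔹 C) =>
    hC.generated_of_polynomiallyEquivalent hA hAS h𝔹 hrank h𝔸
  exact ⟨hpoly, fun h𝔸' C hC => hC.generated_of_termEquivalent hA hAS h𝔹 hrank h𝔸',
    fun _ => FinitaryAlgebra.finite_setOf_isClonoid (n + 1) hpoly⟩
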